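/- Let $N\ge 1$, $\mathbf p\in(1,\infty)$, and let $\gamma,a>0$ satisfy $\frac{N+2}{\gamma^2}+a^2=\mathbf p-1$ and either ($a\le 1$ and $\gamma a>1$) or ($a\ge 1$ and $\gamma>1$). Let $\mathcal D\subset\mathbb R^N$ be open, bounded and connected, and for $\epsilon\in(0,1)$ put $d_\epsilon(x)=\frac1\epsilon\min\{\epsilon,\mathrm{dist}(x,\mathbb R^N\setminus\mathcal D)\}$. **Dynamic programming principle.** For $\rho,\alpha>0$ and $\nu\in\mathbb R^N$ with $|\nu|=1$ or $\nu=0$ let $$E(x,\rho;\alpha,\nu)=\Big\{w\in\mathbb R^N:\ \tfrac{\langle w-x,\nu\rangle^2}{\alpha^2}+\big|w-x-\langle w-x,\nu\rangle\nu\big|^2<\rho^2\Big\}.$$ For a bounded Borel function $u:\mathbb R^N\to\mathbb R$, $r>0$, $x_0\in\mathbb R^N$ and $x\in B(x_0,r)$ let $f_u(x;x_0,r)$ be the average of $u$ (with respect to Lebesgue measure) over $E\big(x,\gamma r;\,1+(a-1)\frac{|x-x_0|^2}{r^2},\,\frac{x-x_0}{|x-x_0|}\big)$, where $\frac{x-x_0}{|x-x_0|}$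 is read as $0$ if $x=x_0$, and let $S_ru(x_0)=\frac12\big(\inf_{x\in B(x_0,r)}f_u(x;x_0,r)+\sup_{x\in B(x_0,r)}f_u(x;x_0,r)\big)$. Given a bounded function $F\in\mathcal C(\mathbb R^N)$ and $\epsilon\in(0,1)$, let $u_\epsilon:\mathbb R^N\to\mathbb R$ be the bounded Borel solution of $$u(x)=d_\epsilon(x)\,S_\epsilon u(x)+(1-d_\epsilon(x))\,F(x)\qquad\text{for all }x\in\mathbb R^N.$$ **Game.** Let $\Omega_1=B(0,1)\times\{1,2\}\times(0,1)$ with the product $\mathbb P_1$ of normalised Lebesgue measure on $B(0,1)\subset\mathbb R^N$, the uniform measure on $\{1,2\}$ and Lebesgue measure on $(0,1)$, and let $\mathbb P$ be the product measure on $\Omega=\Omega_1^{\mathbb N}\ni\{(w_n,s_n,t_n)\}_{n\ge1}$. A strategy is a sequence $\sigma=\{\sigma^n\}_{n\ge0}$ of measurable maps $\sigma^n:H_n=\mathbb R^N\times(\mathbb R^N\times\Omega_1)^n\to B(0,1)$. Given $\epsilon\in(0,1)$, $x\in\mathbb R^N$ and strategies $\sigma_I,\sigma_{II}$, let $X_0=x$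 and, for $n\ge1$, $$X_n=X_{n-1}+\epsilon\big(\sigma+\gamma w_n+\gamma(a-1)\langle w_n,\sigma\rangle\sigma\big),\qquad \sigma=\begin{cases}\sigma_I^{n-1}(h_{n-1}) & s_n=1,\\ \sigma_{II}^{n-1}(h_{n-1}) & s_n=2,\end{cases}$$ where $h_{n-1}=\big(x,(X_1,w_1,s_1,t_1),\dots,(X_{n-1},w_{n-1},s_{n-1},t_{n-1})\big)$, and let $\tau=\min\{n\ge1:\ t_n>d_\epsilon(X_{n-1})\}\in\mathbb N\cup\{\infty\}$. **Game-regularity.** A point $x_0\in\partial\mathcal D$ is game-regular if for all $\eta,\delta>0$ there are $\hat\delta\in(0,\delta)$ and $\hat\epsilon\in(0,1)$ such that for every $\epsilon\in(0,\hat\epsilon)$ and $x\in B(x_0,\hat\delta)$ there is a strategy $\sigma_{I}$ such that for every strategy $\sigma_{II}$ $$\mathbb P\big(\tau<\infty\ \text{and}\ X_{\tau-1}\in B(x_0,\delta)\big)\ge 1-\eta.$$ The set $\mathcal D$ is game-regular if every $x_0\in\partial\mathcal D$ is. **Theorem.** If $\mathcal D$ is game-regular, then for every bounded $F\in\mathcal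 C(\mathbb R^N)$ the family $\{u_\epsilon\}_{\epsilon\in(0,1)}$ is (uniformly) equicontinuous on $\overline{\mathcal D}$: for every $\eta>0$ there is $\delta>0$ such that $|u_\epsilon(x)-u_\epsilon(y)|<\eta$ for all $\epsilon\in(0,1)$ and all $x,y\in\overline{\mathcal D}$ with $|x-y|<\delta$. -/

import Mathlib

open MeasureTheory Set Metric

noncomputable section

namespace TugOfWar

/-- The space `ℝ^N` with its Euclidean norm. -/
abbrev Pt (N : ℕ) : Type := EuclideanSpace ℝ (Fin N)

/-! ### Averages on ellipses and the dynamic programming principle -/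

/-- The ellipse `E(x, ρ; α, ν)` centered at `x`, with radius `ρ` and aspect ratio `α` along `ν`.
For `ν = 0` this is the ball `B(x, ρ)`. -/
def ellipse {N : ℕ} (x : Pt N) (ρ α : ℝ) (ν : Pt N) : Set (Pt N) :=
  {w | (inner ℝ (w - x) ν) ^ 2 / α ^ 2 + ‖(w - x) - (inner ℝ (w - x) ν) • ν‖ ^ 2 < ρ ^ 2}

/-- The averaging operator: the mean value of `u` over `E(x, ρ; α, ν)`. -/
def ellipseAverage {N : ℕ} (u : Pt N → ℝ) (ρ α : ℝ) (ν : Pt N) (x : Pt N) : ℝ :=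
  ⨍ w in ellipse x ρ α ν, u w

/-- `f_u(x; x₀, r)`: the average of `u` on the ellipse centered at `x`, of radius `γ r` and aspect
ratio `1 + (a - 1) |x - x₀|² / r²` along `(x - x₀) / |x - x₀|` (read as `0` when `x = x₀`). -/
def shiftAverage {N : ℕ} (γ a : ℝ) (u : Pt N → ℝ) (x x₀ : Pt N) (r : ℝ) : ℝ :=
  ellipseAverage u (γ * r) (1 + (a - 1) * ‖x - x₀‖ ^ 2 / r ^ 2) (‖x - x₀‖⁻¹ • (x - x₀)) x

/-- `S_r u (x₀) = ½ (inf + sup)_{x ∈ B(x₀, r)} f_u(x; x₀, r)`. -/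
def meanOp {N : ℕ} (γ a r : ℝ) (u : Pt N → ℝ) (x₀ : Pt N) : ℝ :=
  (1 / 2) * ((⨅ x : ball x₀ r, shiftAverage γ a u x x₀ r) +
    ⨆ x : ball x₀ r, shiftAverage γ a u x x₀ r)

/-- The scaled distance `d_ε(x) = ε⁻¹ min {ε, dist (x, ℝ^N ∖ D)}`. -/
def scaledDist {N : ℕ} (D : Set (Pt N)) (ε : ℝ) (x : Pt N) : ℝ :=
  (1 / ε) * min ε (infDist x Dᶜ)

/-- `u` is a bounded Borel solution, on the whole of `ℝ^N`, of the dynamic programming principle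
`u = d_ε S_ε u + (1 - d_ε) F`. -/
structure IsDPPSolution {N : ℕ} (D : Set (Pt N)) (γ a ε : ℝ) (F u : Pt N → ℝ) : Prop where
  measurable : Measurable u
  bounded : ∃ C : ℝ, ∀ x, |u x| ≤ C
  eq : ∀ x, u x = scaledDist D ε x * meanOp γ a ε u x + (1 - scaledDist D ε x) * F x

/-! ### The Tug of War game with noise -/

/-- The outcome space `Ω₁ = B(0,1) × {1,2} × (0,1)` of one round; the coin value `0 : Fin 2`
activates player I and `1 : Fin 2` activates player II. -/
abbrev Round (N : ℕ) : Type := ball (0 : Pt N) 1 × Fin 2 × Ioo (0 : ℝ) 1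

/-- Normalised Lebesgue measure on the unit ball. -/
def ballLaw (N : ℕ) : Measure (ball (0 : Pt N) 1) :=
  (volume (ball (0 : Pt N) 1))⁻¹ • (volume : Measure (Pt N)).comap Subtype.val

/-- Lebesgue measure on the interval `(0,1)`. -/
def thresholdLaw : Measure (Ioo (0 : ℝ) 1) :=
  (volume : Measure ℝ).comap Subtype.val

/-- The uniform probability on the two outcomes of the coin. -/
def coinLaw : Measure (Fin 2) :=
  ProbabilityTheory.uniformOn univ

/-- The law `ℙ₁` of one round: the product of normalised Lebesgue measure on the ball, the fair
coin, and Lebesgue measure on `(0,1)`. -/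
def roundLaw (N : ℕ) : Measure (Round N) :=
  (ballLaw N).prod (coinLaw.prod thresholdLaw)

instance (N : ℕ) : IsProbabilityMeasure (ballLaw N) where
  measure_univ := by
    rw [ballLaw, Measure.smul_apply, comap_subtype_coe_apply measurableSet_ball, image_univ,
      Subtype.range_coe, smul_eq_mul]
    exact ENNReal.inv_mul_cancel (measure_ball_pos _ _ one_pos).ne' measure_ball_lt_top.ne

instance : IsProbabilityMeasure thresholdLaw where
  measure_univ := by
    rw [thresholdLaw, comap_subtype_coe_apply measurableSet_Ioo, image_univ, Subtype.range_coe]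
    simp

instance : IsProbabilityMeasure coinLaw :=
  ProbabilityTheory.isProbabilityMeasure_uniformOn finite_univ univ_nonempty

instance (N : ℕ) : IsProbabilityMeasure (roundLaw N) := by
  unfold roundLaw
  infer_instance

/-- The probability `ℙ` on `Ω = Ω₁^ℕ`: the countable product of copies of `ℙ₁`. The `n`-th
coordinate (`n = 0, 1, …`) of `ω` is the outcome `(w_{n+1}, s_{n+1}, t_{n+1})` of round `n + 1`. -/
def gameLaw (N : ℕ) : Measure (ℕ → Round N) :=
  Measure.infinitePi fun _ => roundLaw N

/-- Finite histories `H_n = ℝ^N × (ℝ^N × Ω₁)^n`. -/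
abbrev History (N n : ℕ) : Type := Pt N × (Fin n → Pt N × Round N)

/-- The last position recorded in a history. -/
def History.last {N : ℕ} : {n : ℕ} → History N n → Pt N
  | 0, h => h.1
  | n + 1, h => (h.2 (Fin.last n)).1

/-- A strategy: a sequence of measurable maps from histories to the open unit ball. -/
structure Strategy (N : ℕ) where
  move : (n : ℕ) → History N n → ball (0 : Pt N) 1
  measurable_move : ∀ n, Measurable (move n)

/-- The history `h_n` generated by the outcomes `ω` from the starting position `x₀`. If
`σ` is the move of the player activated by the coin in the next round, then
`x_{n+1} = x_n + ε (σ + γ w_{n+1} + γ (a - 1) ⟨w_{n+1}, σ⟩ σ)`. -/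
def history {N : ℕ} (γ a ε : ℝ) (x₀ : Pt N) (σ₁ σ₂ : Strategy N) (ω : ℕ → Round N) :
    (n : ℕ) → History N n
  | 0 => (x₀, Fin.elim0)
  | n + 1 =>
    let h := history γ a ε x₀ σ₁ σ₂ ω n
    let w : Pt N := (ω n).1
    let σ : Pt N := if (ω n).2.1 = 0 then σ₁.move n h else σ₂.move n h
    (x₀, Fin.snoc h.2
      (h.last + ε • (σ + γ • w + (γ * (a - 1) * inner ℝ w σ) • σ), ω n))

/-- The position `X_n` of the token. -/
def position {N : ℕ} (γ a ε : ℝ) (x₀ : Pt N) (σ₁ σ₂ : Strategy N) (n : ℕ) (ω : ℕ → Round N) :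
    Pt N :=
  (history γ a ε x₀ σ₁ σ₂ ω n).last

/-- The stopping time `τ = min {n ≥ 1 : t_n > d_ε(x_{n-1})}` (with `n + 1` in place of `n`), equal
to `⊤` if there is no such `n`. -/
def stoppingTime {N : ℕ} (D : Set (Pt N)) (γ a ε : ℝ) (x₀ : Pt N) (σ₁ σ₂ : Strategy N)
    (ω : ℕ → Round N) : ℕ∞ :=
  ⨅ (n : ℕ) (_ : scaledDist D ε (position γ a ε x₀ σ₁ σ₂ n ω) < ((ω n).2.2 : ℝ)),
    ((n + 1 : ℕ) : ℕ∞)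

/-- The event that the game stops (`τ < ∞`) and that the stopping position `X_{τ-1}` is in `B`. -/
def stopsIn {N : ℕ} (D : Set (Pt N)) (γ a ε : ℝ) (x₀ : Pt N) (σ₁ σ₂ : Strategy N)
    (B : Set (Pt N)) : Set (ℕ → Round N) :=
  {ω | ∃ n : ℕ, stoppingTime D γ a ε x₀ σ₁ σ₂ ω = ((n + 1 : ℕ) : ℕ∞) ∧
    position γ a ε x₀ σ₁ σ₂ n ω ∈ B}

/-- Game-regularity of a boundary point `x₀`. -/
def GameRegularAt {N : ℕ} (D : Set (Pt N)) (γ a : ℝ) (x₀ : Pt N) : Prop :=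
  ∀ η > 0, ∀ δ > 0, ∃ δ' ∈ Ioo (0 : ℝ) δ, ∃ ε' ∈ Ioo (0 : ℝ) 1,
    ∀ ε ∈ Ioo (0 : ℝ) ε', ∀ x ∈ ball x₀ δ',
      ∃ σ₁ : Strategy N, ∀ σ₂ : Strategy N,
        1 - η ≤ (gameLaw N).real (stopsIn D γ a ε x σ₁ σ₂ (ball x₀ δ))

/-- `D` is game-regular if each of its boundary points is. -/
def GameRegular {N : ℕ} (D : Set (Pt N)) (γ a : ℝ) : Prop :=
  ∀ x₀ ∈ frontier D, GameRegularAt D γ a x₀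

end TugOfWar

end

noncomputable section
namespace TugOfWar

/-! Scales bounded below and small scales need different arguments. At scale `ε ≥ ρ` averaging
regularises: translating the position amounts to translating the noise in the unit ball, and the two
unit balls overlap up to a volume proportional to the shift. Hence `S_ε u` is Lipschitz with a
constant of order `1/ρ`; so is `d_ε`, and `F` is uniformly continuous on the compact closure
(`exists_le_add_of_scale_ge`).

At small scales the game controls the boundary. Whatever player I does, player II can choose almost
minimising moves, making the expected payoff at most `u x + η` (`exists_strategy_stopsIn_le`).
Game-regularity gives player I a strategy that stops near `x₀` with probability close to one against
every opponent. Playing the two against each other, with data shifted to be nonnegative, gives `F x₀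
- η ≤ u` near `x₀`. The pair `(-F, -u)` gives the reverse bound, and compactness of the frontier
makes the small oscillation uniform (`GameRegular.exists_osc_le`).

The interior follows by comparing `u` with its translate by `h`. Away from the boundary both are
fixed by the mean operator, so their difference is dominated by its best average over moves, and a
maximum principle transports the bound inwards (`IsDPPSolution.le_translate`). That principle
(`le_of_le_moveAverage`) rests on `1 < γ * min 1 a`: the noise can cancel any move and still push in
a prescribed direction with probability bounded below, so finitely many lucky rounds leave any
bounded set. -/

variable {N : ℕ}

/-! ### The linear distortion of the noise and the jump of the token -/

/-- The displacement, in units of `ε`, produced by the move `z` and the noise `w`. -/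
def jump (γ a : ℝ) (z w : Pt N) : Pt N :=
  z + γ • w + (γ * (a - 1) * inner ℝ w z) • z

/-- The linear distortion `w ↦ w + (a - 1) ⟨w, z⟩ z` of the noise. -/
def distortion (a : ℝ) (z : Pt N) : Pt N →ₗ[ℝ] Pt N where
  toFun w := w + ((a - 1) * inner ℝ w z) • z
  map_add' v w := by
    simp only [inner_add_left]
    module
  map_smul' c w := by
    simp only [real_inner_smul_left, RingHom.id_apply]
    module

lemma distortion_apply (a : ℝ) (z w : Pt N) :
    distortion a z w = w + ((a - 1) * inner ℝ w z) • z := rfl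

lemma jump_eq (γ a : ℝ) (z w : Pt N) : jump γ a z w = z + γ • distortion a z w := by
  rw [jump, distortion_apply]
  module

/-- The expectation of `u` after the move `z` from the position `x`. -/
def moveAverage (γ a ε : ℝ) (u : Pt N → ℝ) (x z : Pt N) : ℝ :=
  ∫ w, u (x + ε • jump γ a z (w : Pt N)) ∂ballLaw N

/-- The aspect ratio interpolates linearly between `1` and `a`, so it stays above the smaller
endpoint. -/
lemma min_le_aspect {a t : ℝ} (h0 : 0 ≤ t) (h1 : t ≤ 1) : min 1 a ≤ 1 + (a - 1) * t := by
  rcases le_total 1 a with h | h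
  · rw [min_eq_left h]; nlinarith
  · rw [min_eq_right h]; nlinarith

/-- Pairing the distorted vector with `w` gives the quadratic form `‖w‖² + (a - 1)⟨w, z⟩²`, which is
at least `min 1 a * ‖w‖²`; Cauchy–Schwarz then removes one factor `‖w‖`. -/
lemma norm_le_norm_distortion {a : ℝ} {z : Pt N} (hz : ‖z‖ ≤ 1) (w : Pt N) :
    min 1 a * ‖w‖ ≤ ‖distortion a z w‖ := by
  rcases eq_or_ne w 0 with rfl | hw
  · simp
  have hw0 : 0 < ‖w‖ := norm_pos_iff.2 hw
  have h1 : inner ℝ (distortion a z w) w = ‖w‖ ^ 2 + (a - 1) * (inner ℝ w z) ^ 2 := by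
    rw [distortion_apply, inner_add_left, real_inner_smul_left, real_inner_self_eq_norm_sq,
      real_inner_comm z w]
    rw [real_inner_comm w z]; ring
  have h2 : inner ℝ (distortion a z w) w ≤ ‖distortion a z w‖ * ‖w‖ := real_inner_le_norm _ _
  have h3 : (inner ℝ w z) ^ 2 ≤ ‖w‖ ^ 2 := by
    have := abs_real_inner_le_norm w z
    rw [← sq_abs]
    apply pow_le_pow_left₀ (abs_nonneg _)
    nlinarith
  have h4 : min 1 a * ‖w‖ ^ 2 ≤ ‖w‖ ^ 2 + (a - 1) * (inner ℝ w z) ^ 2 := by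
    rcases le_total 1 a with h | h
    · rw [min_eq_left h]; nlinarith [sq_nonneg (inner ℝ w z : ℝ)]
    · rw [min_eq_right h]; nlinarith [sq_nonneg (inner ℝ w z : ℝ)]
  nlinarith

lemma norm_distortion_le {a : ℝ} {z : Pt N} (hz : ‖z‖ ≤ 1) (w : Pt N) :
    ‖distortion a z w‖ ≤ (1 + |a - 1|) * ‖w‖ := by
  rw [distortion_apply]
  have h := abs_real_inner_le_norm w z
  calc ‖w + ((a - 1) * inner ℝ w z) • z‖ ≤ ‖w‖ + ‖((a - 1) * inner ℝ w z) • z‖ := norm_add_le _ _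
    _ = ‖w‖ + |a - 1| * |inner ℝ w z| * ‖z‖ := by rw [norm_smul, Real.norm_eq_abs, abs_mul]
    _ ≤ ‖w‖ + |a - 1| * ‖w‖ * 1 := by
        gcongr
        exact h.trans (mul_le_of_le_one_right (norm_nonneg _) hz)
    _ = _ := by ring

lemma norm_jump_le {γ : ℝ} (a : ℝ) (hγ : 0 < γ) {z w : Pt N} (hz : ‖z‖ ≤ 1)
    (hw : ‖w‖ ≤ 1) : ‖jump γ a z w‖ ≤ 1 + γ * (1 + |a - 1|) := by
  rw [jump_eq]
  refine (norm_add_le _ _).trans ?_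
  rw [norm_smul, Real.norm_of_nonneg hγ.le]
  have := norm_distortion_le (a := a) hz w
  have : ‖distortion a z w‖ ≤ (1 + |a - 1|) * 1 := this.trans (by gcongr)
  rw [mul_one] at this
  gcongr

lemma distortion_injective {a : ℝ} (ha : 0 < a) {z : Pt N} (hz : ‖z‖ ≤ 1) :
    Function.Injective (distortion a z) := by
  rw [← LinearMap.ker_eq_bot, LinearMap.ker_eq_bot']
  intro w hw
  have := norm_le_norm_distortion (a := a) hz w
  rw [hw, norm_zero] at this
  have hm : 0 < min 1 a := lt_min one_pos ha
  exact norm_le_zero_iff.1 (nonpos_of_mul_nonpos_right this hm)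

lemma distortion_surjective {a : ℝ} (ha : 0 < a) {z : Pt N} (hz : ‖z‖ ≤ 1) :
    Function.Surjective (distortion a z) :=
  LinearMap.surjective_of_injective (distortion_injective ha hz)

lemma continuous_jump (γ a : ℝ) : Continuous fun q : Pt N × Pt N => jump γ a q.1 q.2 := by
  unfold jump
  fun_prop

/-! ### Ellipse averages as expectations over the noise -/

lemma measurable_move {γ a ε : ℝ} {u : Pt N → ℝ} (hu : Measurable u) (x z : Pt N) :
    Measurable fun w : Pt N => u (x + ε • jump γ a z w) :=
  hu.comp (by unfold jump; fun_prop)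

lemma integral_ballLaw (f : Pt N → ℝ) :
    ∫ w, f (w : Pt N) ∂ballLaw N = ⨍ w in ball (0 : Pt N) 1, f w := by
  rw [ballLaw, integral_smul_measure, integral_subtype_comap measurableSet_ball, setAverage_eq,
    ENNReal.toReal_inv]
  rfl

/-- The move `z` is an eigenvector of the distortion with eigenvalue `1 + (a - 1)‖z‖²`, and the
orthogonal complement is fixed. The ellipse undoes exactly this stretching. -/
lemma ellipse_preimage {γ a ε : ℝ} (hγ : 0 < γ) (ha : 0 < a) (hε : 0 < ε) (x : Pt N) {z : Pt N}
    (hz : ‖z‖ ≤ 1) :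
    (fun w => x + ε • jump γ a z w) ⁻¹'
      ellipse (x + ε • z) (γ * ε) (1 + (a - 1) * ‖z‖ ^ 2) (‖z‖⁻¹ • z) = ball 0 1 := by
  ext w
  have hα : 0 < 1 + (a - 1) * ‖z‖ ^ 2 :=
    (lt_min one_pos ha).trans_le (min_le_aspect (by positivity) (pow_le_one₀ (norm_nonneg _) hz))
  have e1 : x + ε • jump γ a z w - (x + ε • z) = (γ * ε) • distortion a z w := by
    rw [jump_eq]; module
  have key : (inner ℝ (distortion a z w) (‖z‖⁻¹ • z)) ^ 2 / (1 + (a - 1) * ‖z‖ ^ 2) ^ 2 +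
      ‖distortion a z w - (inner ℝ (distortion a z w) (‖z‖⁻¹ • z)) • (‖z‖⁻¹ • z)‖ ^ 2 =
      ‖w‖ ^ 2 := by
    rcases eq_or_ne z 0 with rfl | hz0
    · simp [distortion_apply]
    have hn : 0 < ‖z‖ := norm_pos_iff.2 hz0
    obtain ⟨v, hv⟩ : ∃ v : Pt N, v = ‖z‖⁻¹ • z := ⟨_, rfl⟩
    rw [← hv]
    have hv1 : ‖v‖ = 1 := by rw [hv, norm_smul, norm_inv, norm_norm, inv_mul_cancel₀ hn.ne']
    have hzv : z = ‖z‖ • v := by rw [hv, smul_smul, mul_inv_cancel₀ hn.ne', one_smul]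
    have hd : distortion a z w = w + ((a - 1) * ‖z‖ ^ 2 * inner ℝ w v) • v := by
      rw [distortion_apply]
      nth_rw 1 2 [hzv]
      rw [real_inner_smul_right]
      module
    have hi : inner ℝ (distortion a z w) v = (1 + (a - 1) * ‖z‖ ^ 2) * inner ℝ w v := by
      rw [hd, inner_add_left, real_inner_smul_left, real_inner_self_eq_norm_sq, hv1]; ring
    have hp : distortion a z w - (inner ℝ (distortion a z w) v) • v = w - (inner ℝ w v : ℝ) • v := by
      rw [hi, hd]; module
    rw [hp, hi, mul_pow, mul_div_cancel_left₀ _ (by positivity), norm_sub_sq_real,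
      real_inner_smul_right, norm_smul, hv1, Real.norm_eq_abs, mul_one, sq_abs]
    ring
  have hγε : 0 < γ * ε := mul_pos hγ hε
  rw [mem_preimage, ellipse, mem_ofPred_eq, e1, real_inner_smul_left,
    mul_smul (γ * ε) (inner ℝ _ _ : ℝ), ← smul_sub,
    norm_smul, mul_pow (γ * ε), mul_pow (‖γ * ε‖), Real.norm_of_nonneg hγε.le, mul_div_assoc, ← mul_add, key,
    mem_ball_zero_iff]
  rw [mul_lt_iff_lt_one_right (by positivity), sq_lt_one_iff₀ (norm_nonneg _)]

lemma map_affine_volume {A : Pt N →ₗ[ℝ] Pt N} (hA : Function.Injective A) (b : Pt N) :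
    ∃ c : ENNReal, c ≠ 0 ∧ c ≠ ⊤ ∧
      (volume : Measure (Pt N)).map (fun w => b + A w) = c • volume := by
  have hdet : LinearMap.det A ≠ 0 := by
    intro h
    have := LinearMap.bot_lt_ker_of_det_eq_zero h
    rw [LinearMap.ker_eq_bot.2 hA] at this
    exact lt_irrefl _ this
  refine ⟨ENNReal.ofReal |(LinearMap.det A)⁻¹|, ?_, ENNReal.ofReal_ne_top, ?_⟩
  · simpa using hdet
  · have hm : Measurable A := A.continuous_of_finiteDimensional.measurable
    have h1 : (fun w => b + A w) = (fun w => b + w) ∘ A := rfl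
    rw [h1, ← Measure.map_map (measurable_const_add b) hm,
      Measure.map_linearMap_addHaar_eq_smul_addHaar _ hdet, Measure.map_smul, map_add_left_eq_self]

lemma jump_affine (γ a ε : ℝ) (x z w : Pt N) :
    x + ε • jump γ a z w = (x + ε • z) + ((γ * ε) • distortion a z) w := by
  rw [jump_eq, LinearMap.smul_apply]; module

/-- An injective affine map sends Lebesgue measure on the ball to a constant multiple of Lebesgue
measure on the image ellipse; normalising removes the constant. This ties the analytic operator to
one round of the game. -/
lemma shiftAverage_eq_moveAverage {γ a ε : ℝ} (hγ : 0 < γ) (ha : 0 < a) (hε : 0 < ε)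
    {u : Pt N → ℝ} (hu : Measurable u) (x : Pt N) {z : Pt N} (hz : ‖z‖ ≤ 1) :
    shiftAverage γ a u (x + ε • z) x ε = moveAverage γ a ε u x z := by
  have hm : Measurable fun w => x + ε • jump γ a z w := measurable_id.comp (by unfold jump; fun_prop)
  have hα : 1 + (a - 1) * ‖x + ε • z - x‖ ^ 2 / ε ^ 2 = 1 + (a - 1) * ‖z‖ ^ 2 := by
    rw [add_sub_cancel_left, norm_smul, Real.norm_of_nonneg hε.le]
    field_simp
  have hν : ‖x + ε • z - x‖⁻¹ • (x + ε • z - x) = ‖z‖⁻¹ • z := by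
    rw [add_sub_cancel_left, norm_smul, Real.norm_of_nonneg hε.le, smul_smul, mul_inv, mul_assoc,
      mul_comm ‖z‖⁻¹, ← mul_assoc, inv_mul_cancel₀ hε.ne', one_mul]
  have hA : Function.Injective ((γ * ε) • distortion a z) := by
    intro v w h
    simp only [LinearMap.smul_apply] at h
    exact distortion_injective ha hz (smul_right_injective _ (mul_pos hγ hε).ne' h)
  obtain ⟨c, hc0, hct, hc⟩ := map_affine_volume hA (x + ε • z)
  simp_rw [← jump_affine] at hc
  rw [shiftAverage, hα, hν, ellipseAverage, moveAverage,
    integral_ballLaw (fun w => u (x + ε • jump γ a z w))]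
  set E := ellipse (x + ε • z) (γ * ε) (1 + (a - 1) * ‖z‖ ^ 2) (‖z‖⁻¹ • z) with hE
  have hEm : MeasurableSet E := by
    rw [hE]; unfold ellipse
    exact measurableSet_lt (by fun_prop) (by fun_prop)
  have h1 : ((volume : Measure (Pt N)).restrict (ball 0 1)).map
      (fun w => x + ε • jump γ a z w) = c • volume.restrict E := by
    rw [← ellipse_preimage hγ ha hε x hz, ← Measure.restrict_map hm hEm, hc, Measure.restrict_smul]
  have h2 : ⨍ w in ball (0 : Pt N) 1, u (x + ε • jump γ a z w) =
      ⨍ w, u w ∂((volume : Measure (Pt N)).restrict (ball 0 1)).map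
        (fun w => x + ε • jump γ a z w) := by
    rw [average_eq, average_eq, integral_map hm.aemeasurable hu.aestronglyMeasurable]
    congr 2
    rw [measureReal_def, measureReal_def, Measure.map_apply hm MeasurableSet.univ, preimage_univ]
  rw [h2, h1, average, average]
  congr 1
  rw [Measure.smul_apply, smul_smul, smul_eq_mul, ENNReal.mul_inv (Or.inl hc0) (Or.inl hct),
    mul_assoc, mul_comm _ c, ← mul_assoc, ENNReal.inv_mul_cancel hc0 hct, one_mul]

lemma abs_moveAverage_le {γ a ε C : ℝ} {u : Pt N → ℝ} (hC : ∀ x, |u x| ≤ C) (x z : Pt N) :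
    |moveAverage γ a ε u x z| ≤ C := by
  have := norm_integral_le_of_norm_le_const (μ := ballLaw N)
    (f := fun w => u (x + ε • jump γ a z (w : Pt N))) (C := C) (.of_forall fun w => hC _)
  simpa [moveAverage] using this

lemma integrable_move {γ a ε C : ℝ} {u : Pt N → ℝ} (hu : Measurable u) (hC : ∀ x, |u x| ≤ C)
    (x z : Pt N) : Integrable (fun w : ball (0 : Pt N) 1 => u (x + ε • jump γ a z w)) (ballLaw N) :=
  .of_bound ((measurable_move hu x z).comp measurable_subtype_coe).aestronglyMeasurable C
    (.of_forall fun _ => hC _)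

/-! ### Lipschitz dependence of averages on the position -/

/-- Moving a unit ball by `k` changes the mean of a function bounded by `C` by at most
`2 C N ‖k‖`. -/
lemma abs_average_ball_shift_le (hN : 1 ≤ N) {v : Pt N → ℝ} (hv : Measurable v) {C : ℝ}
    (hC : ∀ x, |v x| ≤ C) (k : Pt N) :
    |(⨍ w in ball (0 : Pt N) 1, v (k + w)) - ⨍ w in ball (0 : Pt N) 1, v w| ≤
      2 * C * N * ‖k‖ := by
  have hC0 : 0 ≤ C := (abs_nonneg _).trans (hC 0)
  have hV : 0 < (volume : Measure (Pt N)).real (ball 0 1) :=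
    ENNReal.toReal_pos (measure_ball_pos _ _ one_pos).ne' measure_ball_lt_top.ne
  have hN' : (1 : ℝ) ≤ N := by exact_mod_cast hN
  set V := (volume : Measure (Pt N)).real (ball 0 1) with hVdef
  have hint : ∀ s : Set (Pt N), volume s ≠ ⊤ → IntegrableOn v s := fun s hs =>
    Measure.integrableOn_of_bounded hs hv.aestronglyMeasurable (M := C) (.of_forall fun x => hC x)
  have hshift : ∫ w in ball (0 : Pt N) 1, v (k + w) = ∫ w in ball k 1, v w := by
    have h := (measurePreserving_add_left (volume : Measure (Pt N)) k).setIntegral_preimage_emb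
      (measurableEmbedding_addLeft k) v (ball k 1)
    rw [← h]
    congr 2
    ext w
    simp [mem_ball, dist_eq_norm]
  rw [setAverage_eq, setAverage_eq, hshift, ← smul_sub, smul_eq_mul, abs_mul, ← hVdef,
    abs_of_pos (inv_pos.2 hV), inv_mul_le_iff₀ hV]
  have bound : ∀ s : Set (Pt N), volume s ≠ ⊤ → |∫ w in s, v w| ≤ C * volume.real s :=
    fun s hs => by
      simpa using norm_setIntegral_le_of_norm_le_const (f := v) (C := C) hs.lt_top fun x _ => hC x
  have hVk : (volume : Measure (Pt N)).real (ball k 1) = V := by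
    rw [hVdef, measureReal_def, measureReal_def, Measure.addHaar_ball_center]
  -- For `1 ≤ ‖k‖` the trivial bound `2 * C` suffices, because `1 ≤ N`.
  rcases le_or_gt 1 ‖k‖ with hk | hk
  · have h1 := bound (ball k 1) measure_ball_lt_top.ne
    have h2 := bound (ball 0 1) measure_ball_lt_top.ne
    rw [hVk] at h1
    refine (abs_sub _ _).trans ((add_le_add h1 h2).trans ?_)
    have : 1 ≤ N * ‖k‖ := by nlinarith
    have hCV : 0 ≤ C * V := by positivity
    rw [← hVdef]
    nlinarith
  -- This ball lies in both unit balls, so its contribution cancels. By Bernoulli each unit ball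
  -- exceeds it by volume at most `N * ‖k‖ * V`.
  set I := ball (0 : Pt N) (1 - ‖k‖) with hI
  have hI0 : I ⊆ ball 0 1 := ball_subset_ball (by linarith [norm_nonneg k])
  have hIk : I ⊆ ball k 1 := ball_subset_ball' (by simp [dist_eq_norm])
  have hVI : volume.real I = (1 - ‖k‖) ^ N * V := by
    rw [hI, hVdef, measureReal_def, measureReal_def,
      Measure.addHaar_ball_of_pos _ _ (by linarith : 0 < 1 - ‖k‖), ENNReal.toReal_mul,
      ENNReal.toReal_ofReal (by have : 0 ≤ 1 - ‖k‖ := by linarith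
                                positivity), finrank_euclideanSpace_fin]
  have hbern : 1 - N * ‖k‖ ≤ (1 - ‖k‖) ^ N := by
    have := one_add_mul_le_pow (a := -‖k‖) (by linarith) N
    rw [← sub_eq_add_neg] at this
    linarith
  have split : ∀ s : Set (Pt N), MeasurableSet s → volume s ≠ ⊤ → I ⊆ s → volume.real s = V →
      |(∫ w in s, v w) - ∫ w in I, v w| ≤ C * (N * ‖k‖ * V) := by
    intro s hs hst his hsV
    rw [← setIntegral_sdiff measurableSet_ball (hint s hst) his]
    refine (bound _ (measure_ne_top_of_subset sdiff_subset hst)).trans ?_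
    gcongr
    rw [measureReal_sdiff his measurableSet_ball hst, hsV, hVI]
    nlinarith
  have h1 := split (ball k 1) measurableSet_ball measure_ball_lt_top.ne hIk hVk
  have h2 := split (ball 0 1) measurableSet_ball measure_ball_lt_top.ne hI0 rfl
  rw [abs_le] at h1 h2 ⊢
  constructor <;> nlinarith [h1.1, h1.2, h2.1, h2.2]

/-- `moveAverage` is Lipschitz in the position, uniformly in the move. -/
lemma abs_moveAverage_sub_le (hN : 1 ≤ N) {γ a ε C : ℝ} (hγ : 0 < γ) (ha : 0 < a) (hε : 0 < ε)
    {u : Pt N → ℝ} (hu : Measurable u) (hC : ∀ x, |u x| ≤ C) (x y : Pt N) {z : Pt N}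
    (hz : ‖z‖ ≤ 1) :
    |moveAverage γ a ε u x z - moveAverage γ a ε u y z| ≤
      2 * C * N / (γ * min 1 a * ε) * ‖x - y‖ := by
  have hC0 : 0 ≤ C := (abs_nonneg _).trans (hC 0)
  have hm : 0 < min 1 a := lt_min one_pos ha
  -- This `k` is the shift of the noise that has the same effect as moving the token from `y` to
  -- `x`.
  obtain ⟨k, hk⟩ := distortion_surjective ha hz ((γ * ε)⁻¹ • (x - y))
  have h := abs_average_ball_shift_le hN (measurable_move (γ := γ) (a := a) (ε := ε) hu y z)
    (fun w => hC _) k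
  have he : ∀ w, y + ε • jump γ a z (k + w) = x + ε • jump γ a z w := by
    intro w
    rw [jump_eq, jump_eq, map_add, hk, smul_add, smul_add, smul_add, smul_add, smul_smul, smul_smul,
      mul_comm ε γ, mul_inv_cancel₀ (mul_pos hγ hε).ne']
    module
  simp_rw [he] at h
  rw [moveAverage, moveAverage, integral_ballLaw (fun w => u (x + ε • jump γ a z w)),
    integral_ballLaw (fun w => u (y + ε • jump γ a z w))]
  refine h.trans ?_
  have hk' := norm_le_norm_distortion (a := a) hz k
  rw [hk, norm_smul, norm_inv, Real.norm_of_nonneg (mul_pos hγ hε).le] at hk'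
  have : ‖k‖ ≤ ‖x - y‖ / (γ * min 1 a * ε) := by
    rw [le_div_iff₀ (by positivity)]
    have := mul_le_mul_of_nonneg_left hk' (mul_pos hγ hε).le
    rw [← mul_assoc (γ * ε) (γ * ε)⁻¹, mul_inv_cancel₀ (mul_pos hγ hε).ne'] at this
    linarith
  calc 2 * C * N * ‖k‖ ≤ 2 * C * N * (‖x - y‖ / (γ * min 1 a * ε)) := by gcongr
    _ = _ := by ring

/-! ### Order, sign and bounds for the mean operator -/

lemma meanOp_eq {γ a ε : ℝ} (hγ : 0 < γ) (ha : 0 < a) (hε : 0 < ε) {u : Pt N → ℝ}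
    (hu : Measurable u) (x : Pt N) :
    meanOp γ a ε u x = (1 / 2) * ((⨅ z : ball (0 : Pt N) 1, moveAverage γ a ε u x z) +
      ⨆ z : ball (0 : Pt N) 1, moveAverage γ a ε u x z) := by
  have hmem : ∀ z : ball (0 : Pt N) 1, x + ε • (z : Pt N) ∈ ball x ε := by
    rintro ⟨z, hz⟩
    rw [mem_ball_zero_iff] at hz
    rw [mem_ball, dist_eq_norm, add_sub_cancel_left, norm_smul, Real.norm_of_nonneg hε.le]
    nlinarith
  let f : ball (0 : Pt N) 1 → ball x ε := fun z => ⟨x + ε • (z : Pt N), hmem z⟩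
  have hf : Function.Surjective f := by
    rintro ⟨y, hy⟩
    rw [mem_ball, dist_eq_norm] at hy
    refine ⟨⟨ε⁻¹ • (y - x), ?_⟩, ?_⟩
    · rw [mem_ball_zero_iff, norm_smul, norm_inv, Real.norm_of_nonneg hε.le,
        inv_mul_lt_iff₀ hε, mul_one]
      exact hy
    · simp [f, smul_smul, mul_inv_cancel₀ hε.ne']
  have h : ∀ z, shiftAverage γ a u (f z) x ε = moveAverage γ a ε u x z := fun z =>
    shiftAverage_eq_moveAverage hγ ha hε hu x (mem_ball_zero_iff.1 z.2).le
  rw [meanOp, hf.iInf_congr f h |>.symm, hf.iSup_congr f h |>.symm]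

lemma bddAbove_moveAverage {γ a ε C : ℝ} {u : Pt N → ℝ} (hC : ∀ x, |u x| ≤ C) (x : Pt N) :
    BddAbove (range fun z : ball (0 : Pt N) 1 => moveAverage γ a ε u x z) :=
  ⟨C, by rintro _ ⟨z, rfl⟩; exact (abs_le.1 (abs_moveAverage_le hC x z)).2⟩

lemma bddBelow_moveAverage {γ a ε C : ℝ} {u : Pt N → ℝ} (hC : ∀ x, |u x| ≤ C) (x : Pt N) :
    BddBelow (range fun z : ball (0 : Pt N) 1 => moveAverage γ a ε u x z) :=
  ⟨-C, by rintro _ ⟨z, rfl⟩; exact (abs_le.1 (abs_moveAverage_le hC x z)).1⟩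

instance : Nonempty (ball (0 : Pt N) 1) := ⟨⟨0, mem_ball_self one_pos⟩⟩

/-- Comparing the same move at the two positions bounds the infima and the suprema alike. -/
lemma meanOp_le_add {γ a ε C C' c : ℝ} (hγ : 0 < γ) (ha : 0 < a) (hε : 0 < ε) {u v : Pt N → ℝ}
    (hu : Measurable u) (hv : Measurable v) (hC : ∀ x, |u x| ≤ C) (hC' : ∀ x, |v x| ≤ C')
    {x y : Pt N}
    (h : ∀ z, ‖z‖ < 1 → moveAverage γ a ε u x z ≤ moveAverage γ a ε v y z + c) :
    meanOp γ a ε u x ≤ meanOp γ a ε v y + c := by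
  rw [meanOp_eq hγ ha hε hu, meanOp_eq hγ ha hε hv]
  have h1 : (⨅ z : ball (0 : Pt N) 1, moveAverage γ a ε u x z) - c ≤
      ⨅ z : ball (0 : Pt N) 1, moveAverage γ a ε v y z := by
    refine le_ciInf fun z => ?_
    have h2 := ciInf_le (bddBelow_moveAverage (γ := γ) (a := a) (ε := ε) hC x) z
    have h3 := h z (mem_ball_zero_iff.1 z.2)
    linarith
  have h2 : (⨆ z : ball (0 : Pt N) 1, moveAverage γ a ε u x z) ≤
      (⨆ z : ball (0 : Pt N) 1, moveAverage γ a ε v y z) + c := by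
    refine ciSup_le fun z => ?_
    have h2 := le_ciSup (bddAbove_moveAverage (γ := γ) (a := a) (ε := ε) hC' y) z
    have h3 := h z (mem_ball_zero_iff.1 z.2)
    linarith
  linarith

lemma meanOp_le {γ a ε C c : ℝ} (hγ : 0 < γ) (ha : 0 < a) (hε : 0 < ε) {u : Pt N → ℝ}
    (hu : Measurable u) (hC : ∀ x, |u x| ≤ C) {x : Pt N}
    (h : ∀ z, ‖z‖ < 1 → moveAverage γ a ε u x z ≤ c) : meanOp γ a ε u x ≤ c := by
  rw [meanOp_eq hγ ha hε hu]
  have h2 : (⨆ z : ball (0 : Pt N) 1, moveAverage γ a ε u x z) ≤ c :=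
    ciSup_le fun z => h z (mem_ball_zero_iff.1 z.2)
  have h1 := ciInf_le_ciSup (bddBelow_moveAverage (γ := γ) (a := a) (ε := ε) hC x)
    (bddAbove_moveAverage hC x)
  linarith

/-- The arbitrary move is bounded by the supremum and the almost minimising one by the infimum plus
`η`. This is what player II gains in one round. -/
lemma moveAverage_add_le {γ a ε C η : ℝ} (hγ : 0 < γ) (ha : 0 < a) (hε : 0 < ε) {u : Pt N → ℝ}
    (hu : Measurable u) (hC : ∀ x, |u x| ≤ C) {x z₁ z₂ : Pt N} (hz₁ : ‖z₁‖ < 1)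
    (h : ∀ z, ‖z‖ < 1 → moveAverage γ a ε u x z₂ ≤ moveAverage γ a ε u x z + η) :
    moveAverage γ a ε u x z₁ + moveAverage γ a ε u x z₂ ≤ 2 * meanOp γ a ε u x + η := by
  rw [meanOp_eq hγ ha hε hu]
  have h1 := le_ciSup (bddAbove_moveAverage (γ := γ) (a := a) (ε := ε) hC x)
    ⟨z₁, mem_ball_zero_iff.2 hz₁⟩
  have h2 : moveAverage γ a ε u x z₂ - η ≤ ⨅ z : ball (0 : Pt N) 1, moveAverage γ a ε u x z :=
    le_ciInf fun z => by linarith [h z (mem_ball_zero_iff.1 z.2)]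
  dsimp only at h1
  linarith

lemma moveAverage_neg (γ a ε : ℝ) (u : Pt N → ℝ) (x z : Pt N) :
    moveAverage γ a ε (-u) x z = -moveAverage γ a ε u x z := integral_neg _

lemma moveAverage_add_const {γ a ε C : ℝ} {u : Pt N → ℝ} (hu : Measurable u)
    (hC : ∀ x, |u x| ≤ C) (c : ℝ) (x z : Pt N) :
    moveAverage γ a ε (fun y => u y + c) x z = moveAverage γ a ε u x z + c := by
  rw [moveAverage, integral_add (integrable_move hu hC x z) (integrable_const c)]
  simp [moveAverage]

lemma meanOp_neg {γ a ε : ℝ} (hγ : 0 < γ) (ha : 0 < a) (hε : 0 < ε) {u : Pt N → ℝ}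
    (hu : Measurable u) (x : Pt N) :
    meanOp γ a ε (-u) x = -meanOp γ a ε u x := by
  rw [meanOp_eq hγ ha hε hu, meanOp_eq hγ ha hε hu.neg]
  simp_rw [moveAverage_neg]
  have h1 : ∀ f : ball (0 : Pt N) 1 → ℝ, (⨅ z, -f z) = -⨆ z, f z := fun f => by
    rw [iInf, iSup, Real.sInf_def]
    congr 2
    ext y
    simp [neg_eq_iff_eq_neg]
  have h2 := h1 fun z => -moveAverage γ a ε u x z
  simp only [neg_neg] at h2
  rw [h1, h2]
  ring

/-! ### The scaled distance, and negation of solutions -/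

lemma scaledDist_nonneg (D : Set (Pt N)) {ε : ℝ} (hε : 0 < ε) (x : Pt N) :
    0 ≤ scaledDist D ε x :=
  mul_nonneg (by positivity) (le_min hε.le infDist_nonneg)

lemma scaledDist_le_one (D : Set (Pt N)) {ε : ℝ} (hε : 0 < ε) (x : Pt N) :
    scaledDist D ε x ≤ 1 := by
  rw [scaledDist, one_div, inv_mul_le_iff₀ hε, mul_one]
  exact min_le_left _ _

lemma scaledDist_of_notMem {D : Set (Pt N)} {ε : ℝ} (hε : 0 < ε) {x : Pt N} (hx : x ∉ D) :
    scaledDist D ε x = 0 := by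
  rw [scaledDist, infDist_zero_of_mem (show x ∈ Dᶜ from hx), min_eq_right hε.le, mul_zero]

lemma scaledDist_eq_one {D : Set (Pt N)} {ε : ℝ} (hε : 0 < ε) {x : Pt N} (hx : ε ≤ infDist x Dᶜ) :
    scaledDist D ε x = 1 := by
  rw [scaledDist, min_eq_left hx, one_div, inv_mul_cancel₀ hε.ne']

lemma abs_scaledDist_sub_le (D : Set (Pt N)) {ε : ℝ} (hε : 0 < ε) (x y : Pt N) :
    |scaledDist D ε x - scaledDist D ε y| ≤ ε⁻¹ * ‖x - y‖ := by
  rw [scaledDist, scaledDist, ← mul_sub, abs_mul, one_div, abs_of_pos (inv_pos.2 hε),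
    ← dist_eq_norm]
  refine mul_le_mul_of_nonneg_left ?_ (inv_pos.2 hε).le
  have h := abs_min_sub_min_le_max ε (infDist x Dᶜ) ε (infDist y Dᶜ)
  rw [sub_self, abs_zero] at h
  refine h.trans (max_le dist_nonneg ?_)
  rw [abs_le]
  constructor
  · linarith [infDist_le_infDist_add_dist (s := Dᶜ) (x := y) (y := x), dist_comm x y]
  · linarith [infDist_le_infDist_add_dist (s := Dᶜ) (x := x) (y := y)]

lemma measurable_scaledDist (D : Set (Pt N)) (ε : ℝ) : Measurable (scaledDist D ε) := by
  unfold scaledDist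
  have := (continuous_infDist_pt Dᶜ).measurable
  fun_prop

lemma IsDPPSolution.neg {D : Set (Pt N)} {γ a ε : ℝ} (hγ : 0 < γ) (ha : 0 < a) (hε : 0 < ε)
    {F u : Pt N → ℝ} (h : IsDPPSolution D γ a ε F u) : IsDPPSolution D γ a ε (-F) (-u) where
  measurable := h.measurable.neg
  bounded := by simpa using h.bounded
  eq x := by
    rw [meanOp_neg hγ ha hε h.measurable, Pi.neg_apply, Pi.neg_apply, h.eq x]
    ring

/-! ### Drift of the noise and the maximum principle -/

/-- With probability bounded below, the noise moves the token by a fixed amount in a given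
direction, whatever the move. -/
lemma exists_drift {γ a : ℝ} (hγ : 0 < γ) (ha : 0 < a) (hγa : 1 < γ * min 1 a)
    {e : Pt N} (he : ‖e‖ = 1) :
    ∃ κ > 0, ∃ θ > 0, ∀ z : Pt N, ‖z‖ < 1 → ∃ W : Set (ball (0 : Pt N) 1), MeasurableSet W ∧
      (ballLaw N).real W = θ ∧ ∀ w ∈ W, κ ≤ inner ℝ (jump γ a z w) e := by
  have hm : 0 < min 1 a := lt_min one_pos ha
  set m := min 1 a with hmdef
  have hΛ : 0 < 1 + |a - 1| := by positivity
  set Λ := 1 + |a - 1| with hΛdef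
  have hq1 : (γ * m)⁻¹ < 1 := inv_lt_one_of_one_lt₀ hγa
  set q := (γ * m)⁻¹ with hq
  -- Cancelling the move uses noise of norm at most `q < 1`. Half of the remaining room goes to the
  -- push `c • e` and half to the radius `r`; the second bound on `r` keeps the distorted
  -- fluctuation below half of the push.
  obtain ⟨c, hc⟩ : ∃ c, c = (1 - q) / 2 := ⟨_, rfl⟩
  have hc0 : 0 < c := by rw [hc]; linarith
  obtain ⟨r, hr⟩ : ∃ r, r = min c (c * m / (2 * Λ)) := ⟨_, rfl⟩
  have hr0 : 0 < r := by rw [hr]; exact lt_min hc0 (by positivity)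
  have hrc : r ≤ c := hr.trans_le (min_le_left _ _)
  have hrΛ : Λ * r ≤ c * m / 2 := by
    have : r ≤ c * m / (2 * Λ) := hr.trans_le (min_le_right _ _)
    calc Λ * r ≤ Λ * (c * m / (2 * Λ)) := by gcongr
      _ = c * m / 2 := by field_simp
  refine ⟨γ * (c * m / 2), by positivity,
    ((volume (ball (0 : Pt N) 1))⁻¹ * volume (ball (0 : Pt N) r)).toReal, ?_, fun z hz => ?_⟩
  · refine ENNReal.toReal_pos (mul_ne_zero ?_ (measure_ball_pos _ _ hr0).ne')
      (ENNReal.mul_ne_top ?_ measure_ball_lt_top.ne)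
    · exact ENNReal.inv_ne_zero.2 measure_ball_lt_top.ne
    · exact ENNReal.inv_ne_top.2 (measure_ball_pos _ _ one_pos).ne'
  have hα : m ≤ 1 + (a - 1) * ‖z‖ ^ 2 :=
    min_le_aspect (by positivity) (pow_le_one₀ (norm_nonneg _) hz.le)
  have hα0 : 0 < 1 + (a - 1) * ‖z‖ ^ 2 := hm.trans_le hα
  set α := 1 + (a - 1) * ‖z‖ ^ 2 with hαdef
  -- Noise exactly cancelling the move: `z` is an eigenvector of the distortion with eigenvalue `α`.
  obtain ⟨w₀, hw₀⟩ : ∃ w₀ : Pt N, w₀ = -((γ * α)⁻¹ • z) := ⟨_, rfl⟩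
  have hw₀n : ‖w₀‖ ≤ q := by
    rw [hw₀, norm_neg, norm_smul, norm_inv, Real.norm_of_nonneg (by positivity)]
    calc (γ * α)⁻¹ * ‖z‖ ≤ (γ * m)⁻¹ * 1 := by gcongr
      _ = q := by rw [mul_one]
  have hDw₀ : γ • distortion a z w₀ = -z := by
    rw [hw₀, map_neg, map_smul, distortion_apply, real_inner_self_eq_norm_sq]
    have : z + ((a - 1) * ‖z‖ ^ 2) • z = α • z := by rw [hαdef]; module
    rw [this, smul_smul, smul_neg, smul_smul]
    congr 1
    have : γ * ((γ * α)⁻¹ * α) = 1 := by field_simp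
    rw [this, one_smul]
  have hsub : ball (w₀ + c • e) r ⊆ ball (0 : Pt N) 1 := by
    refine ball_subset_ball' ?_
    rw [dist_zero_right]
    have := norm_add_le w₀ (c • e)
    rw [norm_smul, he, Real.norm_of_nonneg hc0.le] at this
    linarith
  refine ⟨Subtype.val ⁻¹' ball (w₀ + c • e) r, measurable_subtype_coe measurableSet_ball, ?_, ?_⟩
  · rw [measureReal_def, ballLaw, Measure.smul_apply,
      comap_subtype_coe_apply measurableSet_ball, Subtype.image_preimage_coe,
      inter_eq_right.2 hsub, smul_eq_mul,
      Measure.addHaar_ball_center volume (w₀ + c • e) r]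
  · rintro ⟨w, hw1⟩ hw
    simp only [mem_preimage, mem_ball, dist_eq_norm] at hw
    obtain ⟨v, hv⟩ : ∃ v, v = w - (w₀ + c • e) := ⟨_, rfl⟩
    rw [← hv] at hw
    have hw' : w = w₀ + (c • e + v) := by rw [hv]; abel
    have hj : jump γ a z w = γ • (c • distortion a z e + distortion a z v) := by
      rw [jump_eq, hw', map_add, smul_add, hDw₀, map_add, map_smul]; abel
    have h1 : m ≤ inner ℝ (distortion a z e) e := by
      rw [distortion_apply, inner_add_left, real_inner_smul_left, real_inner_self_eq_norm_sq, he,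
        real_inner_comm z e]
      have h2 : |(inner ℝ z e : ℝ)| ≤ 1 := by
        have := abs_real_inner_le_norm z e
        rw [he, mul_one] at this
        linarith
      have h3 := min_le_aspect (a := a) (sq_nonneg (inner ℝ z e : ℝ)) (by rwa [sq_le_one_iff_abs_le_one])
      have h4 : (inner ℝ e z : ℝ) = inner ℝ z e := real_inner_comm _ _
      nlinarith
    have h2 : -(Λ * r) ≤ inner ℝ (distortion a z v) e := by
      have h3 := (abs_le.1 (abs_real_inner_le_norm (distortion a z v) e)).1
      rw [he, mul_one] at h3
      have h4 := norm_distortion_le (a := a) hz.le v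
      have : Λ * ‖v‖ ≤ Λ * r := by gcongr
      linarith
    change _ ≤ inner ℝ (jump γ a z w) e
    rw [hj, real_inner_smul_left, inner_add_left, real_inner_smul_left]
    gcongr
    nlinarith

/-- Maximum principle: a bounded function which, on a bounded set, is dominated by its best
average after a move, is bounded by its values off that set. -/
lemma le_of_le_moveAverage (hN : 1 ≤ N) {γ a ε : ℝ} (hγ : 0 < γ) (ha : 0 < a)
    (hγa : 1 < γ * min 1 a) (hε : 0 < ε) {g : Pt N → ℝ} (hg : Measurable g) {C : ℝ}
    (hC : ∀ x, |g x| ≤ C) {A : Set (Pt N)} (hA : Bornology.IsBounded A) {K : ℝ}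
    (hout : ∀ x ∉ A, g x ≤ K)
    (hin : ∀ x ∈ A, ∀ c, (∀ z, ‖z‖ < 1 → moveAverage γ a ε g x z ≤ c) → g x ≤ max K c)
    (x : Pt N) : g x ≤ K := by
  obtain ⟨e, he⟩ : ∃ e : Pt N, ‖e‖ = 1 := ⟨EuclideanSpace.single ⟨0, hN⟩ 1, by simp⟩
  obtain ⟨κ, hκ, θ, hθ, hW⟩ := exists_drift hγ ha hγa he
  have hθ1 : θ ≤ 1 := by
    obtain ⟨W, -, hWθ, -⟩ := hW 0 (by simp)
    rw [← hWθ]; exact measureReal_le_one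
  obtain ⟨R, hR⟩ := hA.subset_ball 0
  have hAR : ∀ y ∈ A, |(inner ℝ y e : ℝ)| < R := fun y hy => by
    have h1 := abs_real_inner_le_norm y e
    rw [he, mul_one] at h1
    exact h1.trans_lt (mem_ball_zero_iff.1 (hR hy))
  -- Induction on slabs orthogonal to `e`. Beyond the first slab one has left `A`; from slab `k + 1`
  -- the noise reaches slab `k` with probability `θ` whatever the move, and otherwise only the bound
  -- `M` is used.
  have step : ∀ M, K ≤ M → (∀ y, g y ≤ M) → ∀ k : ℕ, ∀ y : Pt N,
      R - k * (ε * κ) ≤ inner ℝ y e → g y ≤ K + (1 - θ ^ k) * (M - K) := by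
    intro M hKM hM k
    induction k with
    | zero =>
      intro y hy
      have : y ∉ A := fun hyA => by
        have := (abs_lt.1 (hAR y hyA)).2
        simp at hy; linarith
      simpa using hout y this
    | succ k ih =>
      intro y hy
      have hθk : θ ^ (k + 1) ≤ 1 := pow_le_one₀ hθ.le hθ1
      have hKc : K ≤ K + (1 - θ ^ (k + 1)) * (M - K) := by nlinarith
      by_cases hyA : y ∈ A
      · refine (hin y hyA _ fun z hz => ?_).trans (max_le hKc le_rfl)
        obtain ⟨W, hWm, hWθ, hWκ⟩ := hW z hz
        calc moveAverage γ a ε g y z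
            ≤ ∫ w, (M - W.indicator (fun _ => θ ^ k * (M - K)) w) ∂ballLaw N := by
              refine integral_mono (integrable_move hg hC y z)
                ((integrable_const _).sub ((integrable_const _).indicator hWm)) fun w => ?_
              by_cases hw : w ∈ W
              · simp only [indicator_of_mem hw]
                have h1 := ih (y + ε • jump γ a z w) (by
                  rw [inner_add_left, real_inner_smul_left]
                  have := mul_le_mul_of_nonneg_left (hWκ w hw) hε.le
                  push_cast at hy
                  linarith)
                linarith
              · simp only [indicator_of_notMem hw, sub_zero]
                exact hM _
          _ = M - θ * (θ ^ k * (M - K)) := by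
              rw [integral_sub (integrable_const _) ((integrable_const _).indicator hWm),
                integral_indicator_const _ hWm, hWθ]
              simp
          _ = K + (1 - θ ^ (k + 1)) * (M - K) := by ring
      · exact (hout y hyA).trans hKc
  -- With `k` steps of length `ε * κ` the slabs cover `A`, whose width along `e` is at most `2 * R`.
  -- Taking `M` to be the supremum of `g` then makes the supremum contract towards `K`.
  obtain ⟨k, hk⟩ := exists_nat_ge (2 * R / (ε * κ))
  have hk' : 2 * R ≤ k * (ε * κ) := (div_le_iff₀ (by positivity)).1 hk
  have bdd : BddAbove (range g) := ⟨C, by rintro _ ⟨y, rfl⟩; exact (abs_le.1 (hC y)).2⟩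
  by_contra! hx
  have hsup : g x ≤ ⨆ y, g y := le_ciSup bdd x
  have key : (⨆ y, g y) ≤ K + (1 - θ ^ k) * ((⨆ y, g y) - K) := by
    refine ciSup_le fun y => ?_
    by_cases hyA : y ∈ A
    · refine step _ (hx.le.trans hsup) (le_ciSup bdd) k y ?_
      have := (abs_lt.1 (hAR y hyA)).1
      linarith
    · have hθk : θ ^ k ≤ 1 := pow_le_one₀ hθ.le hθ1
      have := hout y hyA
      nlinarith
  have : 0 < θ ^ k := by positivity
  nlinarith

/-- Solutions of the dynamic programming principle are bounded by their boundary data. -/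
lemma IsDPPSolution.abs_le (hN : 1 ≤ N) {γ a ε : ℝ} (hγ : 0 < γ) (ha : 0 < a)
    (hγa : 1 < γ * min 1 a) (hε : 0 < ε) {D : Set (Pt N)} (hD : Bornology.IsBounded D)
    {F u : Pt N → ℝ} (h : IsDPPSolution D γ a ε F u) {C : ℝ} (hF : ∀ x, |F x| ≤ C) (x : Pt N) :
    |u x| ≤ C := by
  have aux : ∀ F u : Pt N → ℝ, IsDPPSolution D γ a ε F u → (∀ x, |F x| ≤ C) → ∀ x, u x ≤ C := by
    intro F u h hF
    obtain ⟨C', hC'⟩ := h.bounded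
    refine le_of_le_moveAverage hN hγ ha hγa hε h.measurable hC' hD (fun y hy => ?_)
      fun y _ c hc => ?_
    · rw [h.eq y, scaledDist_of_notMem hε hy]
      simpa using (_root_.abs_le.1 (hF y)).2
    -- The value is a convex combination of a mean at most `c` and a datum at most `C`, hence at
    -- most `max C c`.
    · have h1 := meanOp_le hγ ha hε h.measurable hC' hc
      have h2 := (_root_.abs_le.1 (hF y)).2
      have h3 := scaledDist_nonneg D hε y
      have h4 := scaledDist_le_one D hε y
      rw [h.eq y]
      have h5 := h1.trans (le_max_right C c)
      have h6 := h2.trans (le_max_left C c)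
      nlinarith
  rw [_root_.abs_le]
  have := aux (-F) (-u) (h.neg hγ ha hε) (by simpa using hF) x
  rw [Pi.neg_apply] at this
  exact ⟨by linarith, aux F u h hF x⟩

/-! ### Measurable selection of almost minimising moves -/

/-- Almost minimal moves can be chosen measurably in the position. -/
lemma exists_measurable_almost_minimizer (hN : 1 ≤ N) {γ a ε : ℝ} (hγ : 0 < γ) (ha : 0 < a)
    (hε : 0 < ε) {u : Pt N → ℝ} (hu : Measurable u) {C : ℝ} (hC : ∀ x, |u x| ≤ C) {η : ℝ}
    (hη : 0 < η) :
    ∃ s : Pt N → ball (0 : Pt N) 1, Measurable s ∧ ∀ x z, ‖z‖ < 1 →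
      moveAverage γ a ε u x (s x) ≤ moveAverage γ a ε u x z + η := by
  classical
  have hC0 : 0 ≤ C := (abs_nonneg _).trans (hC 0)
  have hm : 0 < min 1 a := lt_min one_pos ha
  obtain ⟨L, hL⟩ : ∃ L, L = 2 * C * N / (γ * min 1 a * ε) := ⟨_, rfl⟩
  have hL0 : 0 ≤ L := by rw [hL]; positivity
  -- Three errors of `η / 3`: passing from `x` to a nearby point of a dense sequence,
  -- near-optimality there, and passing back.
  obtain ⟨δ, hδ, hLδ⟩ : ∃ δ > 0, L * δ ≤ η / 3 := by
    refine ⟨η / 3 / (L + 1), by positivity, ?_⟩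
    rw [← mul_div_assoc, div_le_iff₀ (by positivity)]
    nlinarith
  have hlip : ∀ x y z : Pt N, ‖z‖ < 1 → dist x y < δ →
      moveAverage γ a ε u x z ≤ moveAverage γ a ε u y z + η / 3 := by
    intro x y z hz hxy
    have h1 := (abs_le.1 (abs_moveAverage_sub_le hN hγ ha hε hu hC x y hz.le)).2
    rw [← hL, ← dist_eq_norm] at h1
    have : L * dist x y ≤ L * δ := by gcongr
    linarith
  have hopt : ∀ q : Pt N, ∃ z : ball (0 : Pt N) 1, ∀ z' : Pt N, ‖z'‖ < 1 →
      moveAverage γ a ε u q z ≤ moveAverage γ a ε u q z' + η / 3 := by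
    intro q
    obtain ⟨z, hz⟩ := exists_lt_of_ciInf_lt (f := fun z : ball (0 : Pt N) 1 =>
      moveAverage γ a ε u q z) (lt_add_of_pos_right _ (by positivity : 0 < η / 3))
    refine ⟨z, fun z' hz' => ?_⟩
    have := ciInf_le (bddBelow_moveAverage (γ := γ) (a := a) (ε := ε) hC q)
      ⟨z', mem_ball_zero_iff.2 hz'⟩
    dsimp only at hz this
    linarith
  choose opt hopt using hopt
  let q : ℕ → Pt N := TopologicalSpace.denseSeq (Pt N)
  have hex : ∀ x, ∃ k, dist x (q k) < δ := fun x =>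
    (TopologicalSpace.denseRange_denseSeq (Pt N)).exists_dist_lt x hδ
  -- Using the first nearby dense point gives a selection with countably many values, so it is
  -- measurable.
  refine ⟨fun x => opt (q (Nat.find (hex x))), ?_, fun x z hz => ?_⟩
  · exact (measurable_from_nat (f := fun k => opt (q k))).comp
      (measurable_find hex fun k => measurableSet_lt (by fun_prop) (by fun_prop))
  · have hk := Nat.find_spec (hex x)
    set k := Nat.find (hex x)
    have h1 := hlip x (q k) (opt (q k)) (mem_ball_zero_iff.1 (opt (q k)).2) hk
    have h2 := hopt (q k) z hz
    have h3 := hlip (q k) x z hz (by rwa [dist_comm])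
    linarith

/-! ### Integrating out one round of the game -/

/-- If `Φ (ω, r)` depends only on `r` and the coordinates `ω i`, `i < n`, then `ω n` may be
integrated out independently. -/
lemma integral_infinitePi_eval {R : Type*} [MeasurableSpace R] (μ : Measure R)
    [IsProbabilityMeasure μ] (n : ℕ) {Φ : (ℕ → R) × R → ℝ} (hΦ : Measurable Φ) {C : ℝ}
    (hC : ∀ q, |Φ q| ≤ C)
    (hloc : ∀ ω ω' : ℕ → R, (∀ i < n, ω i = ω' i) → ∀ r, Φ (ω, r) = Φ (ω', r)) :
    ∫ ω, Φ (ω, ω n) ∂Measure.infinitePi (fun _ => μ) =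
      ∫ ω, ∫ r, Φ (ω, r) ∂μ ∂Measure.infinitePi (fun _ => μ) := by
  classical
  set P := Measure.infinitePi fun _ : ℕ => μ with hP
  obtain ⟨r₀⟩ : Nonempty R := nonempty_of_isProbabilityMeasure μ
  have hind : ProbabilityTheory.iIndepFun (fun i (ω : ℕ → R) => ω i) P :=
    ProbabilityTheory.iIndepFun_infinitePi (P := fun _ : ℕ => μ) (X := fun _ => id)
      fun _ => measurable_id
  have h2 := hind.indepFun_finset (Finset.range n) {n} (by simp) fun i => measurable_pi_apply i
  let ext : (Finset.range n → R) → ℕ → R := fun f i =>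
    if h : i ∈ Finset.range n then f ⟨i, h⟩ else r₀
  have hext : Measurable ext := measurable_pi_iff.2 fun i => by
    by_cases h : i ∈ Finset.range n
    · simp only [ext, dif_pos h]
      exact measurable_pi_apply (⟨i, h⟩ : Finset.range n)
    · simp only [ext, dif_neg h]
      exact measurable_const
  let ev : (({n} : Finset ℕ) → R) → R := fun f => f ⟨n, Finset.mem_singleton_self n⟩
  have h3 := h2.comp hext (measurable_pi_apply _ : Measurable ev)
  -- `T` overwrites all coordinates from `n` on by `r₀`. It is therefore independent of `ω n`, while
  -- `Φ` does not notice the change.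
  let T : (ℕ → R) → ℕ → R := fun ω => ext fun i => ω i
  have hres : Measurable fun (ω : ℕ → R) (i : Finset.range n) => ω i :=
    measurable_pi_iff.2 fun i => measurable_pi_apply _
  have hT : Measurable T := hext.comp hres
  have hTΦ : ∀ ω r, Φ (T ω, r) = Φ (ω, r) := fun ω r => hloc _ _ (fun i hi => by
    simp [T, ext, hi]) r
  have h4 : P.map (fun ω => (T ω, ω n)) = (P.map T).prod μ := by
    have := (ProbabilityTheory.indepFun_iff_map_prod_eq_prod_map_map hT.aemeasurable
      (measurable_pi_apply n).aemeasurable).1 h3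
    rwa [Measure.infinitePi_map_eval (fun _ : ℕ => μ) n] at this
  have : IsProbabilityMeasure (P.map T) := Measure.isProbabilityMeasure_map hT.aemeasurable
  calc ∫ ω, Φ (ω, ω n) ∂P = ∫ ω, Φ (T ω, ω n) ∂P := by simp_rw [hTΦ]
    _ = ∫ q, Φ q ∂(P.map T).prod μ := by
        rw [← h4, integral_map (hT.prodMk (measurable_pi_apply n)).aemeasurable
          hΦ.aestronglyMeasurable]
    _ = ∫ ω, ∫ r, Φ (ω, r) ∂μ ∂P.map T :=
        integral_prod _ (.of_bound hΦ.aestronglyMeasurable C (.of_forall hC))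
    _ = ∫ ω, ∫ r, Φ (T ω, r) ∂μ ∂P :=
        integral_map hT.aemeasurable hΦ.stronglyMeasurable.integral_prod_right'.aestronglyMeasurable
    _ = _ := by simp_rw [hTΦ]

lemma thresholdLaw_real_le {d : ℝ} (h0 : 0 ≤ d) (h1 : d ≤ 1) :
    thresholdLaw.real {t | (t : ℝ) ≤ d} = d := by
  have hm : MeasurableSet {t : Ioo (0 : ℝ) 1 | (t : ℝ) ≤ d} :=
    measurableSet_le measurable_subtype_coe measurable_const
  rw [measureReal_def, thresholdLaw, comap_subtype_coe_apply measurableSet_Ioo]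
  have : Subtype.val '' {t : Ioo (0 : ℝ) 1 | (t : ℝ) ≤ d} = Ioo 0 1 ∩ Iic d := by
    ext t; simp [and_comm]
  rw [this]
  have h2 : volume (Ioo (0 : ℝ) 1 ∩ Iic d) = volume (Ioc (0 : ℝ) d) := by
    rw [measure_congr (Ioo_ae_eq_Ioc.inter (ae_eq_refl (Iic d)))]
    congr 1
    ext t; simp; intro _
    exact fun h => h.trans h1
  rw [h2, Real.volume_Ioc, sub_zero, ENNReal.toReal_ofReal h0]

lemma coinLaw_real_singleton (i : Fin 2) : coinLaw.real {i} = 1 / 2 := by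
  rw [measureReal_def, coinLaw, ProbabilityTheory.uniformOn_univ]
  simp

/-- The expected payoff after one round from `x`, with moves `z i` and survival probability `d`. -/
lemma integral_round {γ a ε : ℝ} {u : Pt N → ℝ} (hu : Measurable u) {C : ℝ} (hC : ∀ x, |u x| ≤ C)
    (x z₁ z₂ : Pt N) {d : ℝ} (h0 : 0 ≤ d) (h1 : d ≤ 1) (f : ℝ) :
    ∫ r : Round N, (if (r.2.2 : ℝ) ≤ d then
        u (x + ε • jump γ a (if r.2.1 = 0 then z₁ else z₂) r.1) else f) ∂roundLaw N =
      d * ((moveAverage γ a ε u x z₁ + moveAverage γ a ε u x z₂) / 2) + (1 - d) * f := by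
  let U : Pt N → ball (0 : Pt N) 1 → ℝ := fun z w => u (x + ε • jump γ a z w)
  let S : Set (Ioo (0 : ℝ) 1) := {t | (t : ℝ) ≤ d}
  have hS : MeasurableSet S := measurableSet_le measurable_subtype_coe measurable_const
  have hcoin : ∀ i : Fin 2, MeasurableSet ({i} : Set (Fin 2)) := fun i => measurableSet_singleton i
  let J : Fin 2 → Fin 2 → ℝ := fun i => indicator {i} 1
  let T : Ioo (0 : ℝ) 1 → ℝ := indicator S 1
  let T' : Ioo (0 : ℝ) 1 → ℝ := indicator Sᶜ 1
  have hU : ∀ z, Integrable (U z) (ballLaw N) := fun z => integrable_move hu hC x z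
  have hJ : ∀ i, Integrable (J i) coinLaw := fun i => (integrable_const 1).indicator (hcoin i)
  have hT : Integrable T thresholdLaw := (integrable_const 1).indicator hS
  have hT' : Integrable T' thresholdLaw := (integrable_const 1).indicator hS.compl
  have hJi : ∀ i, ∫ s, J i s ∂coinLaw = 1 / 2 := fun i => by
    rw [integral_indicator_one (hcoin i), coinLaw_real_singleton]
  have hTi : ∫ t, T t ∂thresholdLaw = d := by
    rw [integral_indicator_one hS, thresholdLaw_real_le h0 h1]
  have hTi' : ∫ t, T' t ∂thresholdLaw = 1 - d := by
    rw [integral_indicator_one hS.compl, probReal_compl_eq_one_sub hS, thresholdLaw_real_le h0 h1]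
  -- Each summand is a product of functions of the noise, the coin and the threshold, so its
  -- integral factorises.
  have hsplit : ∀ r : Round N, (if (r.2.2 : ℝ) ≤ d then
      u (x + ε • jump γ a (if r.2.1 = 0 then z₁ else z₂) r.1) else f) =
      (U z₁ r.1 * (J 0 r.2.1 * T r.2.2) + U z₂ r.1 * (J 1 r.2.1 * T r.2.2)) +
        f * (1 * T' r.2.2) := by
    rintro ⟨w, s, t⟩
    by_cases ht : (t : ℝ) ≤ d
    · have h1 : t ∈ S := ht
      fin_cases s <;> simp [ht, T, T', J, U, h1]
    · have h1 : t ∉ S := ht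
      simp [ht, T, T', h1]
  simp_rw [hsplit]
  have i1 : ∀ i z, Integrable (fun r : Round N => U z r.1 * (J i r.2.1 * T r.2.2)) (roundLaw N) :=
    fun i z => (hU z).mul_prod ((hJ i).mul_prod hT)
  have i2 : Integrable (fun r : Round N => f * (1 * T' r.2.2)) (roundLaw N) :=
    (integrable_const f).mul_prod ((integrable_const (1 : ℝ)).mul_prod hT')
  have e1 : ∀ i z, ∫ r : Round N, U z r.1 * (J i r.2.1 * T r.2.2) ∂roundLaw N =
      moveAverage γ a ε u x z * (1 / 2 * d) := fun i z => by
    rw [roundLaw, integral_prod_mul (U z) fun q : Fin 2 × Ioo (0 : ℝ) 1 => J i q.1 * T q.2,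
      integral_prod_mul (J i) T, hJi, hTi]
    rfl
  have e2 : ∫ r : Round N, f * (1 * T' r.2.2) ∂roundLaw N = f * (1 - d) := by
    rw [roundLaw, integral_prod_mul (fun _ => f) fun q : Fin 2 × Ioo (0 : ℝ) 1 => 1 * T' q.2,
      integral_prod_mul (fun _ => 1) T', hTi']
    simp
  rw [integral_add (by exact (i1 _ _).add (i1 _ _)) i2, integral_add (i1 _ _) (i1 _ _), e1, e1, e2]
  ring

/-! ### Histories, positions and stopping events -/

instance (N : ℕ) : IsProbabilityMeasure (gameLaw N) := by
  unfold gameLaw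
  infer_instance

lemma measurable_history_last : ∀ n, Measurable (History.last : History N n → Pt N)
  | 0 => measurable_fst
  | n + 1 => ((measurable_pi_apply (Fin.last n) : Measurable fun f : Fin (n + 1) → Pt N × Round N =>
      f (Fin.last n)).comp measurable_snd).fst

/-- The move made in round `n + 1`. -/
def activeMove (γ a ε : ℝ) (x₀ : Pt N) (σ₁ σ₂ : Strategy N) (n : ℕ) (ω : ℕ → Round N)
    (s : Fin 2) : Pt N :=
  if s = 0 then σ₁.move n (history γ a ε x₀ σ₁ σ₂ ω n) else σ₂.move n (history γ a ε x₀ σ₁ σ₂ ω n)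

lemma position_succ (γ a ε : ℝ) (x₀ : Pt N) (σ₁ σ₂ : Strategy N) (n : ℕ) (ω : ℕ → Round N) :
    position γ a ε x₀ σ₁ σ₂ (n + 1) ω = position γ a ε x₀ σ₁ σ₂ n ω +
      ε • jump γ a (activeMove γ a ε x₀ σ₁ σ₂ n ω (ω n).2.1) (ω n).1 := by
  simp only [position, history, History.last, Fin.snoc_last]
  rfl

/-- Adaptedness: it lets round `n`, the next one, be integrated out independently of the past. -/
lemma history_congr (γ a ε : ℝ) (x₀ : Pt N) (σ₁ σ₂ : Strategy N) {ω ω' : ℕ → Round N} {n : ℕ}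
    (h : ∀ i < n, ω i = ω' i) :
    history γ a ε x₀ σ₁ σ₂ ω n = history γ a ε x₀ σ₁ σ₂ ω' n := by
  induction n with
  | zero => rfl
  | succ n ih =>
    simp only [history]
    rw [ih fun i hi => h i (by omega), h n (by omega)]

lemma measurable_history (γ a ε : ℝ) (x₀ : Pt N) (σ₁ σ₂ : Strategy N) (n : ℕ) :
    Measurable fun ω => history γ a ε x₀ σ₁ σ₂ ω n := by
  induction n with
  | zero => exact measurable_const
  | succ n ih =>
    simp only [history]
    have hω : Measurable fun ω : ℕ → Round N => ω n := measurable_pi_apply n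
    have hσ : Measurable fun ω : ℕ → Round N =>
        if (ω n).2.1 = 0 then (σ₁.move n (history γ a ε x₀ σ₁ σ₂ ω n) : Pt N)
          else σ₂.move n (history γ a ε x₀ σ₁ σ₂ ω n) :=
      Measurable.ite (hω.snd.fst (measurableSet_singleton 0))
        (((σ₁.measurable_move n).comp ih).subtype_val)
        (((σ₂.measurable_move n).comp ih).subtype_val)
    have hw : Measurable fun ω : ℕ → Round N => ((ω n).1 : Pt N) := hω.fst.subtype_val
    have hX := (measurable_history_last n).comp ih
    refine measurable_const.prodMk (measurable_pi_iff.2 fun i => ?_)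
    refine Fin.lastCases ?_ (fun j => ?_) i
    · simp only [Fin.snoc_last]
      refine Measurable.prodMk (hX.add (Measurable.const_smul ?_ ε)) hω
      have hi := (Measurable.inner (𝕜 := ℝ) hw hσ).const_mul (γ * (a - 1))
      exact (hσ.add (hw.const_smul γ)).add (hi.smul hσ)
    · simp only [Fin.snoc_castSucc]
      exact (measurable_pi_apply j).comp ih.snd

section Game

variable (D : Set (Pt N)) (γ a ε : ℝ) (x₀ : Pt N) (σ₁ σ₂ : Strategy N)

lemma measurable_position (n : ℕ) : Measurable (position γ a ε x₀ σ₁ σ₂ n) :=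
  (measurable_history_last n).comp (measurable_history γ a ε x₀ σ₁ σ₂ n)

/-- The event that the game does not stop in the first `n` rounds. -/
def survives (n : ℕ) : Set (ℕ → Round N) :=
  {ω | ∀ k < n, ((ω k).2.2 : ℝ) ≤ scaledDist D ε (position γ a ε x₀ σ₁ σ₂ k ω)}

/-- The event that the game stops in round `n + 1`. -/
def stopsAt (n : ℕ) : Set (ℕ → Round N) :=
  survives D γ a ε x₀ σ₁ σ₂ n ∩
    {ω | scaledDist D ε (position γ a ε x₀ σ₁ σ₂ n ω) < ((ω n).2.2 : ℝ)}

lemma measurable_scaledDist_position (n : ℕ) :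
    Measurable fun ω => scaledDist D ε (position γ a ε x₀ σ₁ σ₂ n ω) :=
  (measurable_scaledDist D ε).comp (measurable_position γ a ε x₀ σ₁ σ₂ n)

lemma measurable_threshold (n : ℕ) : Measurable fun ω : ℕ → Round N => ((ω n).2.2 : ℝ) :=
  (measurable_pi_apply n : Measurable fun ω : ℕ → Round N => ω n).snd.snd.subtype_val

lemma measurableSet_survives (n : ℕ) : MeasurableSet (survives D γ a ε x₀ σ₁ σ₂ n) := by
  have : survives D γ a ε x₀ σ₁ σ₂ n = ⋂ k, ⋂ _ : k < n,
      {ω | ((ω k).2.2 : ℝ) ≤ scaledDist D ε (position γ a ε x₀ σ₁ σ₂ k ω)} := by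
    ext ω; simp [survives]
  rw [this]
  exact .iInter fun k => .iInter fun _ => measurableSet_le (measurable_threshold k)
    (measurable_scaledDist_position D γ a ε x₀ σ₁ σ₂ k)

lemma measurableSet_stopsAt (n : ℕ) : MeasurableSet (stopsAt D γ a ε x₀ σ₁ σ₂ n) :=
  (measurableSet_survives D γ a ε x₀ σ₁ σ₂ n).inter
    (measurableSet_lt (measurable_scaledDist_position D γ a ε x₀ σ₁ σ₂ n) (measurable_threshold n))

/-- An inclusion suffices, since only upper bounds on the probability of stopping in `B` are derived
from it. -/
lemma stopsIn_subset (B : Set (Pt N)) :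
    stopsIn D γ a ε x₀ σ₁ σ₂ B ⊆
      ⋃ n, stopsAt D γ a ε x₀ σ₁ σ₂ n ∩ position γ a ε x₀ σ₁ σ₂ n ⁻¹' B := by
  rintro ω ⟨n, hn, hB⟩
  have hle : ∀ k, scaledDist D ε (position γ a ε x₀ σ₁ σ₂ k ω) < ((ω k).2.2 : ℝ) → n ≤ k := by
    intro k hk
    have h1 : stoppingTime D γ a ε x₀ σ₁ σ₂ ω ≤ ((k + 1 : ℕ) : ℕ∞) := iInf₂_le k hk
    rw [hn] at h1
    have : n + 1 ≤ k + 1 := by exact_mod_cast h1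
    omega
  refine mem_iUnion.2 ⟨n, ⟨fun k hk => ?_, ?_⟩, hB⟩
  · by_contra! h
    exact absurd (hle k h) (by omega)
  · by_contra h
    -- If index `n` did not stop the game, every stopping index would be at least `n + 1`, and the
    -- index shift would give a stopping time of at least `n + 2`.
    have h2 : ((n + 2 : ℕ) : ℕ∞) ≤ stoppingTime D γ a ε x₀ σ₁ σ₂ ω := by
      refine le_iInf₂ fun k hk => ?_
      have h3 := hle k hk
      have h4 : k ≠ n := fun e => h (e ▸ hk)
      have : n + 2 ≤ k + 1 := by omega
      exact_mod_cast this
    rw [hn] at h2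
    have : n + 2 ≤ n + 1 := by exact_mod_cast h2
    omega

variable {D γ a ε σ₂}

/-! ### The supermartingale bound for the second player -/

/-- One step of the supermartingale inequality: when the second player's move from `X_n` is within
`η` of minimising the average of `u`, the expected payoff does not increase by more than `η`. -/
lemma integral_step_le (hγ : 0 < γ) (ha : 0 < a) (hε : 0 < ε) {F u : Pt N → ℝ}
    (hsol : IsDPPSolution D γ a ε F u) (hFm : Measurable F) {C : ℝ} (hu : ∀ x, |u x| ≤ C)
    (hF : ∀ x, |F x| ≤ C) {η : ℝ} (hη : 0 ≤ η) (n : ℕ)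
    (hσ₂ : ∀ (h : History N n) (z : Pt N), ‖z‖ < 1 →
      moveAverage γ a ε u h.last (σ₂.move n h) ≤ moveAverage γ a ε u h.last z + η) :
    (∫ ω, (survives D γ a ε x₀ σ₁ σ₂ (n + 1)).indicator
        (fun ω => u (position γ a ε x₀ σ₁ σ₂ (n + 1) ω)) ω ∂gameLaw N) +
      ∫ ω, (stopsAt D γ a ε x₀ σ₁ σ₂ n).indicator
        (fun ω => F (position γ a ε x₀ σ₁ σ₂ n ω)) ω ∂gameLaw N ≤
    (∫ ω, (survives D γ a ε x₀ σ₁ σ₂ n).indicator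
        (fun ω => u (position γ a ε x₀ σ₁ σ₂ n ω)) ω ∂gameLaw N) + η := by
  classical
  have hC0 : 0 ≤ C := (abs_nonneg _).trans (hu 0)
  have hXm := fun n => measurable_position γ a ε x₀ σ₁ σ₂ n
  have hSm := fun n => measurableSet_survives D γ a ε x₀ σ₁ σ₂ n
  have hTm := measurableSet_stopsAt D γ a ε x₀ σ₁ σ₂ n
  have hint : ∀ (s : Set (ℕ → Round N)), MeasurableSet s → ∀ (G : Pt N → ℝ), Measurable G →
      (∀ x, |G x| ≤ C) → ∀ n, Integrable (s.indicator
        (fun ω => G (position γ a ε x₀ σ₁ σ₂ n ω))) (gameLaw N) := fun s hs G hG hGC n =>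
    (Integrable.of_bound (hG.comp (hXm n)).aestronglyMeasurable C
      (.of_forall fun _ => hGC _)).indicator hs
  -- The payoff after one more round, with the fresh outcome as a separate variable so that it can
  -- be integrated out with the history frozen.
  let Ψ : (ℕ → Round N) × Round N → ℝ := fun q =>
    if (q.2.2.2 : ℝ) ≤ scaledDist D ε (position γ a ε x₀ σ₁ σ₂ n q.1) then
      u (position γ a ε x₀ σ₁ σ₂ n q.1 +
        ε • jump γ a (activeMove γ a ε x₀ σ₁ σ₂ n q.1 q.2.2.1) q.2.1)
    else F (position γ a ε x₀ σ₁ σ₂ n q.1)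
  let Φ : (ℕ → Round N) × Round N → ℝ := fun q =>
    (survives D γ a ε x₀ σ₁ σ₂ n).indicator (fun ω => Ψ (ω, q.2)) q.1
  have hΨm : Measurable Ψ := by
    have hX1 : Measurable fun q : (ℕ → Round N) × Round N => position γ a ε x₀ σ₁ σ₂ n q.1 :=
      (hXm n).comp measurable_fst
    have hr : Measurable fun q : (ℕ → Round N) × Round N => q.2 := measurable_snd
    have hh : Measurable fun q : (ℕ → Round N) × Round N => history γ a ε x₀ σ₁ σ₂ q.1 n :=
      (measurable_history γ a ε x₀ σ₁ σ₂ n).comp measurable_fst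
    have hmv : Measurable fun q : (ℕ → Round N) × Round N =>
        activeMove γ a ε x₀ σ₁ σ₂ n q.1 q.2.2.1 :=
      Measurable.ite (hr.snd.fst (measurableSet_singleton 0))
        ((σ₁.measurable_move n).comp hh).subtype_val ((σ₂.measurable_move n).comp hh).subtype_val
    refine Measurable.ite (measurableSet_le hr.snd.snd.subtype_val
      ((measurable_scaledDist_position D γ a ε x₀ σ₁ σ₂ n).comp measurable_fst)) ?_ (hFm.comp hX1)
    exact hsol.measurable.comp (hX1.add (((continuous_jump γ a).measurable.comp
      (hmv.prodMk hr.fst.subtype_val)).const_smul ε))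
  have hΦm : Measurable Φ := by
    have : Φ = (Prod.fst ⁻¹' survives D γ a ε x₀ σ₁ σ₂ n).indicator Ψ := by
      ext ⟨ω, r⟩; rfl
    rw [this]
    exact hΨm.indicator (measurable_fst (hSm n))
  have hΨC : ∀ q, |Ψ q| ≤ C := fun q => by
    dsimp only [Ψ]
    split_ifs
    exacts [hu _, hF _]
  have hΦC : ∀ q, |Φ q| ≤ C := fun q => by
    dsimp only [Φ]
    by_cases hq : q.1 ∈ survives D γ a ε x₀ σ₁ σ₂ n
    · rw [indicator_of_mem hq]; exact hΨC _
    · rw [indicator_of_notMem hq, abs_zero]; exact hC0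
  have hloc : ∀ ω ω' : ℕ → Round N, (∀ i < n, ω i = ω' i) → ∀ r, Φ (ω, r) = Φ (ω', r) := by
    intro ω ω' h r
    have hh : ∀ k ≤ n, history γ a ε x₀ σ₁ σ₂ ω k = history γ a ε x₀ σ₁ σ₂ ω' k := fun k hk =>
      history_congr γ a ε x₀ σ₁ σ₂ fun i hi => h i (by omega)
    have hs : ω ∈ survives D γ a ε x₀ σ₁ σ₂ n ↔ ω' ∈ survives D γ a ε x₀ σ₁ σ₂ n := by
      refine forall₂_congr fun k hk => ?_
      rw [position, position, hh k hk.le, h k hk]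
    have hΨ : Ψ (ω, r) = Ψ (ω', r) := by
      simp only [Ψ, position, activeMove, hh n le_rfl]
    by_cases hω : ω ∈ survives D γ a ε x₀ σ₁ σ₂ n
    · simp only [Φ, indicator_of_mem hω, indicator_of_mem (hs.1 hω), hΨ]
    · simp only [Φ, indicator_of_notMem hω, indicator_of_notMem (mt hs.2 hω)]
  -- Surviving round `n + 1` and stopping in it split the event of surviving the first `n` rounds.
  have hpt : ∀ ω, (survives D γ a ε x₀ σ₁ σ₂ (n + 1)).indicator
        (fun ω => u (position γ a ε x₀ σ₁ σ₂ (n + 1) ω)) ω +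
      (stopsAt D γ a ε x₀ σ₁ σ₂ n).indicator (fun ω => F (position γ a ε x₀ σ₁ σ₂ n ω)) ω =
      Φ (ω, ω n) := by
    intro ω
    have hsucc : ω ∈ survives D γ a ε x₀ σ₁ σ₂ (n + 1) ↔ ω ∈ survives D γ a ε x₀ σ₁ σ₂ n ∧
        ((ω n).2.2 : ℝ) ≤ scaledDist D ε (position γ a ε x₀ σ₁ σ₂ n ω) := by
      constructor
      · exact fun h => ⟨fun k hk => h k (by omega), h n (by omega)⟩
      · rintro ⟨h1, h2⟩ k hk
        rcases Nat.lt_succ_iff_lt_or_eq.1 hk with h | rfl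
        exacts [h1 k h, h2]
    by_cases hs : ω ∈ survives D γ a ε x₀ σ₁ σ₂ n
    · by_cases ht : ((ω n).2.2 : ℝ) ≤ scaledDist D ε (position γ a ε x₀ σ₁ σ₂ n ω)
      · have h1 : ω ∉ stopsAt D γ a ε x₀ σ₁ σ₂ n := fun h => absurd ht (not_le.2 h.2)
        rw [indicator_of_mem (hsucc.2 ⟨hs, ht⟩), indicator_of_notMem h1, add_zero, position_succ]
        simp only [Φ, Ψ, indicator_of_mem hs, if_pos ht]
      · have h1 : ω ∈ stopsAt D γ a ε x₀ σ₁ σ₂ n := ⟨hs, not_le.1 ht⟩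
        rw [indicator_of_notMem (fun h => ht (hsucc.1 h).2), indicator_of_mem h1, zero_add]
        simp only [Φ, Ψ, indicator_of_mem hs, if_neg ht]
    · rw [indicator_of_notMem (fun h => hs (hsucc.1 h).1), indicator_of_notMem fun h => hs h.1]
      simp only [Φ, indicator_of_notMem hs, add_zero]
  have hround : ∀ ω, ∫ r, Φ (ω, r) ∂roundLaw N ≤ (survives D γ a ε x₀ σ₁ σ₂ n).indicator
      (fun ω => u (position γ a ε x₀ σ₁ σ₂ n ω)) ω + η := by
    intro ω
    by_cases hs : ω ∈ survives D γ a ε x₀ σ₁ σ₂ n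
    · simp only [Φ, indicator_of_mem hs, Ψ, activeMove]
      have h0 := scaledDist_nonneg D hε (position γ a ε x₀ σ₁ σ₂ n ω)
      have h1 := scaledDist_le_one D hε (position γ a ε x₀ σ₁ σ₂ n ω)
      rw [integral_round hsol.measurable hu _ _ _ h0 h1]
      have h2 := moveAverage_add_le hγ ha hε hsol.measurable hu
        (x := position γ a ε x₀ σ₁ σ₂ n ω)
        (mem_ball_zero_iff.1 (σ₁.move n (history γ a ε x₀ σ₁ σ₂ ω n)).2)
        (hσ₂ (history γ a ε x₀ σ₁ σ₂ ω n))
      rw [hsol.eq (position γ a ε x₀ σ₁ σ₂ n ω)]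
      nlinarith
    · simp only [Φ, indicator_of_notMem hs, integral_zero, zero_add, hη]
  rw [← integral_add (hint _ (hSm _) u hsol.measurable hu _) (hint _ hTm F hFm hF _)]
  simp_rw [hpt]
  rw [gameLaw, integral_infinitePi_eval (roundLaw N) n hΦm hΦC hloc, ← gameLaw]
  have h1 : Integrable (fun ω => ∫ r, Φ (ω, r) ∂roundLaw N) (gameLaw N) :=
    Integrable.of_bound hΦm.stronglyMeasurable.integral_prod_right'.aestronglyMeasurable C
      (.of_forall fun ω => by
        have := norm_integral_le_of_norm_le_const (μ := roundLaw N) (f := fun r => Φ (ω, r))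
          (C := C) (.of_forall fun r => hΦC _)
        simpa using this)
  have h2 := hint _ (hSm n) u hsol.measurable hu n
  calc ∫ ω, ∫ r, Φ (ω, r) ∂roundLaw N ∂gameLaw N ≤ _ :=
        integral_mono h1 (h2.add (integrable_const η)) hround
    _ = _ := by
        simp only [Pi.add_apply]
        rw [integral_add h2 (integrable_const η)]
        simp

end Game

/-- Against any strategy of the first player, the second player can keep the expected payoff below
`u x + η`. In particular if stopping in `B` pays at least `m`, this bounds the probability of
stopping there. -/
lemma exists_strategy_stopsIn_le (hN : 1 ≤ N) {D : Set (Pt N)} {γ a ε : ℝ} (hγ : 0 < γ)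
    (ha : 0 < a) (hε : 0 < ε) {F u : Pt N → ℝ} (hsol : IsDPPSolution D γ a ε F u)
    (hFm : Measurable F) {C : ℝ} (hu : ∀ x, |u x| ≤ C) (hF : ∀ x, |F x| ≤ C)
    (hu0 : ∀ x, 0 ≤ u x) (hF0 : ∀ x, 0 ≤ F x) {B : Set (Pt N)} (hB : MeasurableSet B) {m : ℝ}
    (hm : 0 < m) (hFB : ∀ x ∈ B, m ≤ F x) {η : ℝ} (hη : 0 < η) :
    ∃ σ₂ : Strategy N, ∀ (x : Pt N) (σ₁ : Strategy N),
      m * (gameLaw N).real (stopsIn D γ a ε x σ₁ σ₂ B) ≤ u x + η := by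
  -- Tolerances `η / 2 ^ (n + 1)` sum to at most `η`. The resulting strategy looks only at the
  -- current position.
  choose sel hselm hsel using fun n : ℕ => exists_measurable_almost_minimizer hN hγ ha hε
    hsol.measurable hu (η := η / 2 ^ (n + 1)) (by positivity)
  let σ₂ : Strategy N := ⟨fun n h => sel n h.last, fun n =>
    (hselm n).comp (measurable_history_last n)⟩
  refine ⟨σ₂, fun x σ₁ => ?_⟩
  let A : ℕ → ℝ := fun n => ∫ ω, (survives D γ a ε x σ₁ σ₂ n).indicator
    (fun ω => u (position γ a ε x σ₁ σ₂ n ω)) ω ∂gameLaw N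
  let S : ℕ → ℝ := fun n => ∫ ω, (stopsAt D γ a ε x σ₁ σ₂ n).indicator
    (fun ω => F (position γ a ε x σ₁ σ₂ n ω)) ω ∂gameLaw N
  have hstep : ∀ n, A (n + 1) + S n ≤ A n + η / 2 ^ (n + 1) := fun n =>
    integral_step_le x σ₁ hγ ha hε hsol hFm hu hF (by positivity) n fun h z hz =>
      hsel n h.last z hz
  have hA0 : A 0 = u x := by
    have : survives D γ a ε x σ₁ σ₂ 0 = univ := by ext ω; simp [survives]
    simp only [A, this, indicator_univ]
    simp [position, history, History.last]
  have hsum : ∀ n, A n + ∑ k ∈ Finset.range n, S k ≤ u x + η * (1 - (1 / 2) ^ n) := by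
    intro n
    induction n with
    | zero => simp [hA0]
    | succ n ih =>
      rw [Finset.sum_range_succ]
      have h1 := hstep n
      have h2 : η / 2 ^ (n + 1) = η * ((1 / 2) ^ n - (1 / 2) ^ (n + 1)) := by
        rw [pow_succ, pow_succ, one_div, inv_pow]; field_simp; norm_num
      linarith
  have hAn : ∀ n, 0 ≤ A n := fun n => integral_nonneg fun ω => indicator_nonneg (fun _ _ => hu0 _) _
  let E : ℕ → Set (ℕ → Round N) := fun n =>
    stopsAt D γ a ε x σ₁ σ₂ n ∩ position γ a ε x σ₁ σ₂ n ⁻¹' B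
  have hEm : ∀ n, MeasurableSet (E n) := fun n =>
    (measurableSet_stopsAt D γ a ε x σ₁ σ₂ n).inter (measurable_position γ a ε x σ₁ σ₂ n hB)
  have hS : ∀ n, m * (gameLaw N).real (E n) ≤ S n := by
    intro n
    have h1 : m * (gameLaw N).real (E n) = ∫ ω, (E n).indicator (fun _ => m) ω ∂gameLaw N := by
      rw [integral_indicator_const _ (hEm n), smul_eq_mul, mul_comm]
    rw [h1]
    refine integral_mono ((integrable_const m).indicator (hEm n))
      ((Integrable.of_bound (hFm.comp (measurable_position γ a ε x σ₁ σ₂ n)).aestronglyMeasurable C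
        (.of_forall fun _ => hF _)).indicator (measurableSet_stopsAt D γ a ε x σ₁ σ₂ n))
      fun ω => ?_
    by_cases hω : ω ∈ E n
    · rw [indicator_of_mem hω, indicator_of_mem hω.1]
      exact hFB _ hω.2
    · rw [indicator_of_notMem hω]
      exact indicator_nonneg (fun _ _ => hF0 _) _
  -- The nonnegative surviving term `A n` is dropped, so no claim that the game ends almost surely
  -- is needed.
  have hpartial : ∀ n, ∑ k ∈ Finset.range n, (gameLaw N).real (E k) ≤ (u x + η) / m := by
    intro n
    rw [le_div_iff₀ hm, mul_comm, Finset.mul_sum]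
    have h1 := hsum n
    have h2 := hAn n
    have h3 : ∑ k ∈ Finset.range n, m * (gameLaw N).real (E k) ≤ ∑ k ∈ Finset.range n, S k :=
      Finset.sum_le_sum fun k _ => hS k
    have h4 : 0 ≤ η * (1 / 2) ^ n := by positivity
    linarith
  have hnn : 0 ≤ (u x + η) / m := div_nonneg (by linarith [hu0 x]) hm.le
  have hmeas : gameLaw N (stopsIn D γ a ε x σ₁ σ₂ B) ≤ ENNReal.ofReal ((u x + η) / m) := by
    refine (measure_mono (stopsIn_subset D γ a ε x σ₁ σ₂ B)).trans
      ((measure_iUnion_le _).trans (ENNReal.tsum_le_of_sum_range_le fun n => ?_))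
    have h1 : ∀ k, gameLaw N (E k) = ENNReal.ofReal ((gameLaw N).real (E k)) := fun k =>
      (ofReal_measureReal).symm
    change ∑ k ∈ Finset.range n, gameLaw N (E k) ≤ _
    simp_rw [h1]
    rw [← ENNReal.ofReal_sum_of_nonneg fun _ _ => measureReal_nonneg]
    exact ENNReal.ofReal_le_ofReal (hpartial n)
  have := ENNReal.toReal_le_of_le_ofReal hnn hmeas
  rw [measureReal_def, mul_comm]
  exact (le_div_iff₀ hm).1 this

/-! ### Constant shifts and boundary estimates -/

lemma meanOp_add_const {γ a ε C : ℝ} (hγ : 0 < γ) (ha : 0 < a) (hε : 0 < ε) {u : Pt N → ℝ}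
    (hu : Measurable u) (hC : ∀ x, |u x| ≤ C) (c : ℝ) (x : Pt N) :
    meanOp γ a ε (fun y => u y + c) x = meanOp γ a ε u x + c := by
  have hum : Measurable fun y => u y + c := hu.add_const c
  have huC : ∀ y, |u y + c| ≤ C + |c| := fun y =>
    (_root_.abs_add_le _ _).trans (add_le_add_left (hC y) _)
  have h := moveAverage_add_const (γ := γ) (a := a) (ε := ε) hu hC c x
  apply le_antisymm
  · exact meanOp_le_add hγ ha hε hum hu huC hC fun z _ => (h z).le
  · have := meanOp_le_add (c := -c) hγ ha hε hu hum hC huC (x := x) (y := x)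
      fun z _ => by rw [h]; linarith
    linarith

lemma IsDPPSolution.add_const {D : Set (Pt N)} {γ a ε : ℝ} (hγ : 0 < γ) (ha : 0 < a) (hε : 0 < ε)
    {F u : Pt N → ℝ} (h : IsDPPSolution D γ a ε F u) (c : ℝ) :
    IsDPPSolution D γ a ε (fun x => F x + c) (fun x => u x + c) where
  measurable := h.measurable.add_const c
  bounded := by
    obtain ⟨C, hC⟩ := h.bounded
    exact ⟨C + |c|, fun y => (_root_.abs_add_le _ _).trans (add_le_add_left (hC y) _)⟩
  eq x := by
    obtain ⟨C, hC⟩ := h.bounded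
    rw [meanOp_add_const hγ ha hε h.measurable hC, h.eq x]
    ring

lemma abs_meanOp_le {γ a ε C : ℝ} (hγ : 0 < γ) (ha : 0 < a) (hε : 0 < ε) {u : Pt N → ℝ}
    (hu : Measurable u) (hC : ∀ x, |u x| ≤ C) (x : Pt N) : |meanOp γ a ε u x| ≤ C := by
  rw [abs_le]
  have h1 := meanOp_le (c := C) hγ ha hε hu hC (x := x) fun z _ =>
    (abs_le.1 (abs_moveAverage_le hC x z)).2
  have h2 := meanOp_le (c := C) hγ ha hε hu.neg (C := C) (by simpa using hC) (x := x) fun z _ => by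
    rw [moveAverage_neg]
    linarith [(abs_le.1 (abs_moveAverage_le (γ := γ) (a := a) (ε := ε) hC x z)).1]
  rw [meanOp_neg hγ ha hε hu] at h2
  exact ⟨by linarith, h1⟩

section

variable {γ a : ℝ} {D : Set (Pt N)}

/-- Near a game-regular boundary point, solutions are almost bounded below by their datum. -/
lemma GameRegularAt.exists_le (hN : 1 ≤ N) (hγ : 0 < γ) (ha : 0 < a) (hγa : 1 < γ * min 1 a)
    (hDb : Bornology.IsBounded D) {x₀ : Pt N} (hx₀ : GameRegularAt D γ a x₀) {F : Pt N → ℝ}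
    (hFc : Continuous F) {C : ℝ} (hF : ∀ x, |F x| ≤ C) {η : ℝ} (hη : 0 < η) :
    ∃ ρ ∈ Ioo (0 : ℝ) 1, ∀ ε ∈ Ioo 0 ρ, ∀ u, IsDPPSolution D γ a ε F u →
      ∀ x ∈ ball x₀ ρ, F x₀ - η ≤ u x := by
  have hC0 : 0 ≤ C := (abs_nonneg _).trans (hF 0)
  obtain ⟨θ, hθ0, hθη, hθ1⟩ : ∃ θ > 0, θ ≤ η / 4 ∧ θ ≤ 1 / 2 :=
    ⟨min (η / 4) (1 / 2), lt_min (by positivity) (by norm_num), min_le_left _ _, min_le_right _ _⟩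
  obtain ⟨δ, hδ, hFδ⟩ := Metric.continuousAt_iff.1 (hFc.continuousAt (x := x₀)) θ hθ0
  obtain ⟨δ', hδ', ε', hε', hgame⟩ := hx₀ (η / (4 * (2 * C + 1))) (by positivity) δ hδ
  refine ⟨min δ' ε', ⟨lt_min hδ'.1 hε'.1, (min_le_right _ _).trans_lt hε'.2⟩,
    fun ε hε u hu x hx => ?_⟩
  have huC := hu.abs_le hN hγ ha hγa hε.1 hDb hF
  obtain ⟨σ₁, hσ₁⟩ := hgame ε ⟨hε.1, hε.2.trans_le (min_le_right _ _)⟩ x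
    (ball_subset_ball (min_le_left _ _) hx)
  -- Adding `C + 1` makes data and solution nonnegative. Then `m` bounds the shifted datum below on
  -- `ball x₀ δ`; it is positive because `θ ≤ 1 / 2`, and at most `2 * C + 1`, whence the tolerance
  -- asked of the game.
  obtain ⟨m, hm⟩ : ∃ m, m = F x₀ + C + 1 - θ := ⟨_, rfl⟩
  have hFx₀ := abs_le.1 (hF x₀)
  have hm0 : 0 < m := by linarith
  have hbd : ∀ f : Pt N → ℝ, (∀ x, |f x| ≤ C) → ∀ x, |f x + (C + 1)| ≤ 2 * C + 1 := by
    intro f hf x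
    have := abs_le.1 (hf x)
    exact abs_le.2 ⟨by linarith, by linarith⟩
  have hnn : ∀ f : Pt N → ℝ, (∀ x, |f x| ≤ C) → ∀ x, 0 ≤ f x + (C + 1) := by
    intro f hf x
    have := abs_le.1 (hf x)
    linarith
  obtain ⟨σ₂, hσ₂⟩ := exists_strategy_stopsIn_le hN hγ ha hε.1 (hu.add_const hγ ha hε.1 (C + 1))
    (hFc.measurable.add_const _) (hbd u huC) (hbd F hF) (hnn u huC) (hnn F hF)
    (B := ball x₀ δ) measurableSet_ball hm0 (fun y hy => by
      have := hFδ hy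
      rw [Real.dist_eq] at this
      have := (abs_lt.1 this).1
      linarith) hθ0
  have h1 := hσ₂ x σ₁
  have h2 := mul_le_mul_of_nonneg_left (hσ₁ σ₂) hm0.le
  have h3 : m * (η / (4 * (2 * C + 1))) ≤ η / 4 := by
    calc m * (η / (4 * (2 * C + 1))) ≤ (2 * C + 1) * (η / (4 * (2 * C + 1))) := by
          gcongr; linarith
      _ = η / 4 := by field_simp
  rw [mul_sub, mul_one] at h2
  linarith

/-- Solutions oscillate little near the boundary of a game-regular domain. -/
lemma GameRegular.exists_osc_le (hN : 1 ≤ N) (hγ : 0 < γ) (ha : 0 < a) (hγa : 1 < γ * min 1 a)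
    (hDb : Bornology.IsBounded D) (hD : GameRegular D γ a) {F : Pt N → ℝ} (hFc : Continuous F)
    {C : ℝ} (hF : ∀ x, |F x| ≤ C) {η : ℝ} (hη : 0 < η) :
    ∃ ρ ∈ Ioo (0 : ℝ) 1, ∀ ε ∈ Ioo 0 ρ, ∀ u, IsDPPSolution D γ a ε F u →
      ∀ x ∈ frontier D, ∀ y ∈ ball x ρ, ∀ y' ∈ ball x ρ, u y ≤ u y' + η := by
  have hcomp : IsCompact (frontier D) :=
    Metric.isCompact_of_isClosed_isBounded isClosed_frontier
      (hDb.closure.subset frontier_subset_closure)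
  refine hcomp.induction_on (p := fun s => ∃ ρ ∈ Ioo (0 : ℝ) 1, ∀ ε ∈ Ioo 0 ρ, ∀ u,
    IsDPPSolution D γ a ε F u → ∀ x ∈ s, ∀ y ∈ ball x ρ, ∀ y' ∈ ball x ρ, u y ≤ u y' + η)
    ⟨1 / 2, by norm_num, by simp⟩ ?_ ?_ ?_
  · rintro s t hst ⟨ρ, hρ, h⟩
    exact ⟨ρ, hρ, fun ε hε u hu x hx => h ε hε u hu x (hst hx)⟩
  · rintro s t ⟨ρ, hρ, h⟩ ⟨ρ', hρ', h'⟩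
    refine ⟨min ρ ρ', ⟨lt_min hρ.1 hρ'.1, (min_le_left _ _).trans_lt hρ.2⟩, ?_⟩
    rintro ε hε u hu x (hx | hx) y hy y' hy'
    · exact h ε ⟨hε.1, hε.2.trans_le (min_le_left _ _)⟩ u hu x hx
        y (ball_subset_ball (min_le_left _ _) hy) y' (ball_subset_ball (min_le_left _ _) hy')
    · exact h' ε ⟨hε.1, hε.2.trans_le (min_le_right _ _)⟩ u hu x hx
        y (ball_subset_ball (min_le_right _ _) hy) y' (ball_subset_ball (min_le_right _ _) hy')
  · intro x₀ hx₀
    obtain ⟨ρ, hρ, h⟩ := (hD x₀ hx₀).exists_le hN hγ ha hγa hDb hFc hF (half_pos hη)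
    obtain ⟨ρ', hρ', h'⟩ := (hD x₀ hx₀).exists_le hN hγ ha hγa hDb hFc.neg (C := C)
      (by simpa using hF) (half_pos hη)
    -- Halving leaves room for the centre `x` to vary: balls of radius `r` about points of `ball x₀
    -- r` stay where both one-sided estimates hold.
    set r := min ρ ρ' / 2 with hr
    have hr0 : 0 < r := half_pos (lt_min hρ.1 hρ'.1)
    have hrρ : r + r ≤ ρ := by rw [hr, add_halves]; exact min_le_left _ _
    have hrρ' : r + r ≤ ρ' := by rw [hr, add_halves]; exact min_le_right _ _
    refine ⟨ball x₀ r, mem_nhdsWithin_of_mem_nhds (ball_mem_nhds _ hr0), r,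
      ⟨hr0, by linarith [hρ.2]⟩, fun ε hε u hu x hx y hy y' hy' => ?_⟩
    have hsub : ball x r ⊆ ball x₀ (r + r) := ball_subset_ball' (by
      rw [mem_ball] at hx; linarith)
    have h1 := h ε ⟨hε.1, by linarith [hε.2]⟩ u hu y' (ball_subset_ball hrρ (hsub hy'))
    have h2 := h' ε ⟨hε.1, by linarith [hε.2]⟩ (-u) (hu.neg hγ ha hε.1) y
      (ball_subset_ball hrρ' (hsub hy))
    simp only [Pi.neg_apply] at h2
    linarith

/-! ### From the boundary to the interior -/

/-- Small oscillation near the boundary propagates to the interior: compare a solution with its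
translate. -/
lemma IsDPPSolution.le_translate (hN : 1 ≤ N) (hγ : 0 < γ) (ha : 0 < a) (hγa : 1 < γ * min 1 a)
    (hDo : IsOpen D) (hDb : Bornology.IsBounded D) {F u : Pt N → ℝ} {ε ρ η : ℝ} (hε : 0 < ε)
    (hερ : ε * (1 + γ * (1 + |a - 1|)) ≤ ρ / 4) (hu : IsDPPSolution D γ a ε F u)
    (hosc : ∀ x ∈ frontier D, ∀ y ∈ ball x ρ, ∀ y' ∈ ball x ρ, u y ≤ u y' + η)
    {h : Pt N} (hh : ‖h‖ < ρ / 4) {z : Pt N} (hz : z ∈ D) : u z ≤ u (z + h) + η := by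
  classical
  obtain ⟨C, hC⟩ := hu.bounded
  have hερ' : ε ≤ ρ / 4 := by
    refine le_trans ?_ hερ
    have : 0 ≤ γ * (1 + |a - 1|) := by positivity
    nlinarith
  -- Needed for a nearest frontier point to exist; a bounded set is proper because `1 ≤ N`.
  have hDu : D ≠ univ := by
    rintro rfl
    have : Nontrivial (Pt N) := by
      have : NeZero N := ⟨by omega⟩
      infer_instance
    exact NormedSpace.unbounded_univ ℝ (Pt N) hDb
  have hum : Measurable fun y => u (y + h) := hu.measurable.comp (measurable_add_const h)
  -- Off `D` the value `η` is harmless: it meets the outer bound, and jumps from `A` never leave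
  -- `D`.
  let g : Pt N → ℝ := fun y => if y ∈ D then u y - u (y + h) else η
  have hgm : Measurable g :=
    Measurable.ite hDo.measurableSet (hu.measurable.sub hum) measurable_const
  have hgC : ∀ y, |g y| ≤ 2 * C + |η| := fun y => by
    have h1 := hC y
    have h2 := hC (y + h)
    dsimp only [g]
    split_ifs
    · exact (_root_.abs_sub _ _).trans (by linarith [abs_nonneg η])
    · linarith [abs_nonneg (u y)]
  let A : Set (Pt N) := {y | y ∈ D ∧ ρ / 2 ≤ infDist y Dᶜ}
  have key := le_of_le_moveAverage hN hγ ha hγa hε hgm hgC (A := A) (K := η)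
    (hDb.subset fun y hy => hy.1) (fun y hy => ?_) (fun y hy c hc => ?_) z
  · simp only [g, if_pos hz] at key
    linarith
  · by_cases hyD : y ∈ D
    · have hlt : infDist y Dᶜ < ρ / 2 := not_le.1 fun hle => hy ⟨hyD, hle⟩
      obtain ⟨p, hp, hpd⟩ := exists_mem_frontier_infDist_compl_eq_dist hyD hDu
      rw [hpd] at hlt
      simp only [g, if_pos hyD]
      have h1 := hosc p hp y (by rw [mem_ball]; linarith [norm_nonneg h]) (y + h) (by
        rw [mem_ball]
        have := dist_triangle (y + h) y p
        rw [dist_eq_norm (y + h) y, add_sub_cancel_left] at this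
        linarith [norm_nonneg h])
      linarith
    · simp only [g, if_neg hyD, le_refl]
  · refine le_max_of_le_right ?_
    have hyh : infDist y Dᶜ ≤ infDist (y + h) Dᶜ + ‖h‖ := by
      have := infDist_le_infDist_add_dist (s := Dᶜ) (x := y) (y := y + h)
      rwa [dist_eq_norm, sub_add_cancel_left, norm_neg] at this
    have hy2 := hy.2
    -- Both `y` and `y + h` lie at distance at least `ρ / 4 ≥ ε` from the complement, so the
    -- boundary datum has weight zero.
    have e1 : u y = meanOp γ a ε u y := by
      rw [hu.eq y, scaledDist_eq_one hε (by linarith [norm_nonneg h])]; ring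
    have e2 : u (y + h) = meanOp γ a ε u (y + h) := by
      rw [hu.eq (y + h), scaledDist_eq_one hε (by linarith)]; ring
    simp only [g, if_pos hy.1]
    have := meanOp_le_add (c := c) hγ ha hε hu.measurable hu.measurable hC hC (x := y) (y := y + h)
      fun s hs => by
        have h1 := hc s hs
        have h2 : moveAverage γ a ε g y s =
            moveAverage γ a ε u y s - moveAverage γ a ε u (y + h) s := by
          rw [moveAverage, moveAverage, moveAverage, ← integral_sub
            (integrable_move hu.measurable hC y s) (integrable_move hu.measurable hC (y + h) s)]
          refine integral_congr_ae (.of_forall fun w => ?_)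
          have hin : y + ε • jump γ a s w ∈ D := by
            by_contra hn
            have h3 := infDist_le_dist_of_mem (x := y) (show y + ε • jump γ a s w ∈ Dᶜ from hn)
            rw [dist_eq_norm, sub_add_cancel_left, norm_neg, norm_smul,
              Real.norm_of_nonneg hε.le] at h3
            have h4 := norm_jump_le a hγ hs.le (mem_ball_zero_iff.1 w.2).le
            have h5 := mul_le_mul_of_nonneg_left h4 hε.le
            linarith [norm_nonneg h]
          simp only [g, if_pos hin]
          rw [add_right_comm]
        linarith
    linarith

/-! ### Scales bounded below -/

/-- Solutions at a scale bounded below are equicontinuous. -/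
lemma exists_le_add_of_scale_ge (hN : 1 ≤ N) (hγ : 0 < γ) (ha : 0 < a) (hγa : 1 < γ * min 1 a)
    (hDb : Bornology.IsBounded D) {F : Pt N → ℝ} (hFc : Continuous F)
    {C : ℝ} (hF : ∀ x, |F x| ≤ C) {ρ : ℝ} (hρ : 0 < ρ) {η : ℝ} (hη : 0 < η) :
    ∃ δ > 0, ∀ ε, ρ ≤ ε → ∀ u, IsDPPSolution D γ a ε F u →
      ∀ x ∈ closure D, ∀ y ∈ closure D, dist x y < δ → u x ≤ u y + η := by
  have hC0 : 0 ≤ C := (abs_nonneg _).trans (hF 0)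
  have hm : 0 < min 1 a := lt_min one_pos ha
  have hFu : UniformContinuousOn F (closure D) :=
    hDb.isCompact_closure.uniformContinuousOn_of_continuous hFc.continuousOn
  obtain ⟨δ₁, hδ₁, hFδ⟩ := Metric.uniformContinuousOn_iff.1 hFu (η / 2) (half_pos hη)
  obtain ⟨L, hL⟩ : ∃ L, L = ρ⁻¹ * (2 * C) + 2 * C * N / (γ * min 1 a * ρ) := ⟨_, rfl⟩
  have hL0 : 0 ≤ L := by rw [hL]; positivity
  refine ⟨min δ₁ (η / 2 / (L + 1)), lt_min hδ₁ (by positivity), ?_⟩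
  intro ε hρε u hu x hx y hy hxy
  have hε : 0 < ε := hρ.trans_le hρε
  have huC := hu.abs_le hN hγ ha hγa hε hDb hF
  have hFxy := hFδ x hx y hy (hxy.trans_le (min_le_left _ _))
  rw [Real.dist_eq] at hFxy
  have hFxy' := (abs_lt.1 hFxy).2
  have hLxy : L * dist x y ≤ η / 2 := by
    have h1 := (hxy.trans_le (min_le_right _ _)).le
    rw [le_div_iff₀ (by positivity)] at h1
    nlinarith [dist_nonneg (x := x) (y := y)]
  have hS : meanOp γ a ε u x ≤ meanOp γ a ε u y + 2 * C * N / (γ * min 1 a * ρ) * dist x y := by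
    refine meanOp_le_add hγ ha hε hu.measurable hu.measurable huC huC fun z hz => ?_
    have h1 := (abs_le.1 (abs_moveAverage_sub_le hN hγ ha hε hu.measurable huC x y hz.le)).2
    rw [← dist_eq_norm] at h1
    have h2 : 2 * C * N / (γ * min 1 a * ε) * dist x y ≤
        2 * C * N / (γ * min 1 a * ρ) * dist x y := by gcongr
    linarith
  have hd : |scaledDist D ε x - scaledDist D ε y| ≤ ρ⁻¹ * dist x y := by
    rw [dist_eq_norm]
    refine (abs_scaledDist_sub_le D hε x y).trans ?_
    gcongr
  have hSF : |meanOp γ a ε u x - F x| ≤ 2 * C := by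
    have h1 := abs_meanOp_le hγ ha hε hu.measurable huC x
    have h2 := hF x
    exact (_root_.abs_sub _ _).trans (by linarith)
  -- With `d`, `S` the scaled distance and mean, `u x - u y = (d x - d y)(S x - F x) + d y (S x - S
  -- y) + (1 - d y)(F x - F y)`. The three terms are bounded in turn.
  have h1 : (scaledDist D ε x - scaledDist D ε y) * (meanOp γ a ε u x - F x) ≤
      ρ⁻¹ * dist x y * (2 * C) := by
    refine (le_abs_self _).trans ?_
    rw [abs_mul]
    gcongr
  have h0 := scaledDist_nonneg D hε y
  have h0' := scaledDist_le_one D hε y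
  have hK : 0 ≤ 2 * C * N / (γ * min 1 a * ρ) * dist x y := by positivity
  have h2 : scaledDist D ε y * (meanOp γ a ε u x - meanOp γ a ε u y) ≤
      2 * C * N / (γ * min 1 a * ρ) * dist x y := by nlinarith
  have h3 : (1 - scaledDist D ε y) * (F x - F y) ≤ η / 2 := by nlinarith
  rw [hu.eq x, hu.eq y]
  have h4 : L * dist x y = ρ⁻¹ * dist x y * (2 * C) +
      2 * C * N / (γ * min 1 a * ρ) * dist x y := by rw [hL]; ring
  linarith

end

end TugOfWar
end

/-! ### The two ranges of scales combined -/

theorem theorem5p4 (N : ℕ) (hN : 1 ≤ N)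
    (p γ a : ℝ) (hp : 1 < p) (hγ : 0 < γ) (ha : 0 < a)
    (hscale : ((N : ℝ) + 2) / γ ^ 2 + a ^ 2 = p - 1)
    (hcompat : (a ≤ 1 ∧ 1 < γ * a) ∨ (1 ≤ a ∧ 1 < γ))
    (D : Set (TugOfWar.Pt N)) (hDo : IsOpen D) (hDb : Bornology.IsBounded D) (hDc : IsConnected D)
    (hD : TugOfWar.GameRegular D γ a)
    (F : TugOfWar.Pt N → ℝ) (hFc : Continuous F) (hFb : ∃ C : ℝ, ∀ x, |F x| ≤ C)
    (u : ℝ → TugOfWar.Pt N → ℝ)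
    (hu : ∀ ε ∈ Set.Ioo (0 : ℝ) 1, TugOfWar.IsDPPSolution D γ a ε F (u ε)) :
    UniformEquicontinuousOn (fun ε : Set.Ioo (0 : ℝ) 1 => u ε) (closure D) := by
  have hγa : 1 < γ * min 1 a := by
    rcases hcompat with ⟨h1, h2⟩ | ⟨h1, h2⟩
    · rwa [min_eq_right h1]
    · rwa [min_eq_left h1, mul_one]
  obtain ⟨C, hF⟩ := hFb
  have main : ∀ η > 0, ∃ δ > 0, ∀ ε : Set.Ioo (0 : ℝ) 1, ∀ x ∈ closure D, ∀ y ∈ closure D,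
      dist x y < δ → u ε x ≤ u ε y + η := by
    intro η hη
    obtain ⟨ρ, hρ, hosc⟩ := hD.exists_osc_le hN hγ ha hγa hDb hFc hF hη
    obtain ⟨Λ, hΛ⟩ : ∃ Λ, Λ = 1 + γ * (1 + |a - 1|) := ⟨_, rfl⟩
    have hΛ1 : 1 ≤ Λ := by
      rw [hΛ]
      have : 0 ≤ γ * (1 + |a - 1|) := by positivity
      linarith
    have hρ0 := hρ.1
    obtain ⟨δ, hδ, hlarge⟩ := TugOfWar.exists_le_add_of_scale_ge hN hγ ha hγa hDb hFc hF
      (ρ := ρ / 4 / Λ) (by positivity) hη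
    refine ⟨min δ (ρ / 4), lt_min hδ (by positivity), fun ε x hx y hy hxy => ?_⟩
    -- `ε * Λ` bounds the length of a jump, so below this threshold one round moves the token by at
    -- most `ρ / 4`.
    rcases le_or_gt (ρ / 4 / Λ) ε with hε | hε
    · exact hlarge ε hε _ (hu ε ε.2) x hx y hy (hxy.trans_le (min_le_left _ _))
    have hεΛ : (ε : ℝ) * Λ ≤ ρ / 4 := ((lt_div_iff₀ (by positivity)).1 hε).le
    have hερ : (ε : ℝ) < ρ := by nlinarith [ε.2.1]
    have hosc' := hosc ε ⟨ε.2.1, hερ⟩ _ (hu ε ε.2)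
    have hxy' : dist x y < ρ / 4 := hxy.trans_le (min_le_right _ _)
    by_cases hxD : x ∈ D
    · rw [hΛ] at hεΛ
      have := (hu ε ε.2).le_translate hN hγ ha hγa hDo hDb ε.2.1 hεΛ hosc' (h := y - x)
        (by rwa [← dist_eq_norm, dist_comm]) hxD
      rwa [add_sub_cancel] at this
    · have hxf : x ∈ frontier D := ⟨hx, by rwa [hDo.interior_eq]⟩
      exact hosc' x hxf x (mem_ball_self hρ0) y (by rw [mem_ball, dist_comm]; linarith)
  rw [(Metric.uniformity_basis_dist.inf_principal _).uniformEquicontinuousOn_iff Metric.uniformity_basis_dist]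
  intro η hη
  obtain ⟨δ, hδ, h⟩ := main (η / 2) (half_pos hη)
  refine ⟨δ, hδ, ?_⟩
  rintro x y ⟨hxy, hx, hy⟩ ε
  have h1 := h ε x hx y hy hxy
  have h2 := h ε y hy x hx (by rwa [dist_comm])
  change dist (u ε x) (u ε y) < η
  rw [Real.dist_eq, abs_lt]
  constructor <;> linarith
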